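/- Let $p,q\in\mathbb{N}_0$, let $\mathbf{A}=(A_1,\dots,A_p)$, $\mathbf{B}=(B_1,\dots,B_q)$ be vectors of positive reals and $\mathbf{a}=(a_1,\dots,a_p)$, $\mathbf{b}=(b_1,\dots,b_q)$ vectors of nonnegative reals. Put $$\Delta=\sum_{j=1}^q B_j-\sum_{k=1}^p A_k,\qquad \rho=\prod_{k=1}^p A_k^{A_k}\prod_{j=1}^q B_j^{-B_j},\qquad \mu=\sum_{j=1}^q b_j-\sum_{k=1}^p a_k+\frac{p-q}{2},$$ $$\nu=(2\pi)^{(p-q)/2}\prod_{k=1}^p A_k^{a_k-1/2}\prod_{j=1}^q B_j^{1/2-b_j},\qquad Q(u)=\sum_{i=1}^p\frac{u^{a_i/A_i}}{1-u^{1/A_i}}-\sum_{j=1}^q\frac{u^{b_j/B_j}}{1-u^{1/B_j}}\quad(0<u<1).$$ Let $H$ be Fox's function $$H(x)=H^{p,0}_{q,p}\left(x\,\middle|\,\begin{array}{c}(\mathbf{B},\mathbf{b})\\(\mathbf{A},\mathbf{a})\end{array}\right)=\frac{1}{2\pi i}\int_{\mathcal{L}}\frac{\prod_{k=1}^p\Gamma(A_ks+a_k)}{\prod_{j=1}^q\Gamma(B_js+b_j)}\,x^{-s}\,ds,$$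 where $\mathcal{L}$ is a left loop that runs along straight segments from $-\infty+i\varphi_1$ to $c+i\varphi_1$, then to $c+i\varphi_2$, then to $-\infty+i\varphi_2$; here $\varphi_1<0<\varphi_2$ and $c>-a_k/A_k$ for all $k$, so that all the poles of the numerator lie inside the loop. Suppose that $\mu=0$, $\rho\le 1$ and $\Delta=0$. Then, for every such loop $\mathcal{L}$ and every $x\in(0,\rho)$, the integral that defines $H(x)$ converges absolutely, the function $u\mapsto H(u)\,Q(x/u)/u$ is integrable over $(x,\rho)$, and $$H(x)=\frac{1}{\log(\rho/x)}\left(\nu\,Q(x/\rho)+\int_x^{\rho}H(u)\,\frac{Q(x/u)}{u}\,du\right).$$ -/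

import Mathlib

noncomputable section

namespace FoxH

/-- The gamma ratio `∏ₖ Γ(Aₖ s + aₖ) / ∏ⱼ Γ(Bⱼ s + bⱼ)`. Where a denominator factor has a pole,
Mathlib's `Complex.Gamma` is `0`, so that its reciprocal is `0`, which is the value there of the
entire function `1 / Γ`. -/
def gammaRatio {p q : ℕ} (A a : Fin p → ℝ) (B b : Fin q → ℝ) (s : ℂ) : ℂ :=
  (∏ k, Complex.Gamma ((A k : ℂ) * s + (a k : ℂ))) /
    ∏ j, Complex.Gamma ((B j : ℂ) * s + (b j : ℂ))

/-- The integral of `F` along the left loop that runs from `-∞ + i φ₁` horizontally to `c + i φ₁`,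
then vertically up to `c + i φ₂`, then horizontally back to `-∞ + i φ₂`. -/
def leftLoopIntegral (c φ₁ φ₂ : ℝ) (F : ℂ → ℂ) : ℂ :=
  (∫ t in Set.Iic c, F ((t : ℂ) + (φ₁ : ℂ) * Complex.I))
    + Complex.I * (∫ t in φ₁..φ₂, F ((c : ℂ) + (t : ℂ) * Complex.I))
    - ∫ t in Set.Iic c, F ((t : ℂ) + (φ₂ : ℂ) * Complex.I)

/-- Absolute convergence of the integral of `F` along the left loop of `leftLoopIntegral`. -/
def LeftLoopIntegrable (c φ₁ φ₂ : ℝ) (F : ℂ → ℂ) : Prop :=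
  MeasureTheory.IntegrableOn (fun t : ℝ => F ((t : ℂ) + (φ₁ : ℂ) * Complex.I)) (Set.Iic c) ∧
  IntervalIntegrable (fun t : ℝ => F ((c : ℂ) + (t : ℂ) * Complex.I))
    MeasureTheory.volume φ₁ φ₂ ∧
  MeasureTheory.IntegrableOn (fun t : ℝ => F ((t : ℂ) + (φ₂ : ℂ) * Complex.I)) (Set.Iic c)

/-- The left loop with parameters `c, φ₁, φ₂` has all the poles `-(aₖ + n) / Aₖ` (`n ∈ ℕ`) of the
numerator of the gamma ratio on its left, that is, inside (for `A > 0`). -/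
def IsAdmissibleLoop {p : ℕ} (A a : Fin p → ℝ) (c φ₁ φ₂ : ℝ) : Prop :=
  φ₁ < 0 ∧ 0 < φ₂ ∧ ∀ k, -(a k / A k) < c

/-- The integrand `s ↦ (∏ₖ Γ(Aₖ s + aₖ) / ∏ⱼ Γ(Bⱼ s + bⱼ)) x ^ (-s)`. -/
def integrand {p q : ℕ} (A a : Fin p → ℝ) (B b : Fin q → ℝ) (x : ℝ) (s : ℂ) : ℂ :=
  gammaRatio A a B b s * (x : ℂ) ^ (-s)

/-- Fox's function `H^{p,0}_{q,p}(x)` with upper parameters `(B, b)` and lower parameters `(A, a)`: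
the Mellin-Barnes integral over the left loop given by `c, φ₁, φ₂`. -/
def foxH {p q : ℕ} (A a : Fin p → ℝ) (B b : Fin q → ℝ) (c φ₁ φ₂ : ℝ) (x : ℝ) : ℂ :=
  1 / (2 * (Real.pi : ℂ) * Complex.I) * leftLoopIntegral c φ₁ φ₂ (integrand A a B b x)

/-- `ρ = ∏ₖ Aₖ ^ Aₖ ∏ⱼ Bⱼ ^ (-Bⱼ)`. -/
def rho {p q : ℕ} (A : Fin p → ℝ) (B : Fin q → ℝ) : ℝ :=
  (∏ k, (A k) ^ (A k)) * ∏ j, (B j) ^ (-(B j))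

/-- `μ = ∑ⱼ bⱼ - ∑ₖ aₖ + (p - q) / 2`. -/
def mu {p q : ℕ} (a : Fin p → ℝ) (b : Fin q → ℝ) : ℝ :=
  ∑ j, b j - ∑ k, a k + ((p : ℝ) - (q : ℝ)) / 2

/-- `ν = (2π) ^ ((p - q) / 2) ∏ₖ Aₖ ^ (aₖ - 1/2) ∏ⱼ Bⱼ ^ (1/2 - bⱼ)`. -/
def nu {p q : ℕ} (A a : Fin p → ℝ) (B b : Fin q → ℝ) : ℝ :=
  (2 * Real.pi) ^ (((p : ℝ) - (q : ℝ)) / 2) *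
    (∏ k, (A k) ^ (a k - 1 / 2)) * ∏ j, (B j) ^ (1 / 2 - b j)

/-- `Q(u) = ∑ᵢ u ^ (aᵢ / Aᵢ) / (1 - u ^ (1 / Aᵢ)) - ∑ⱼ u ^ (bⱼ / Bⱼ) / (1 - u ^ (1 / Bⱼ))`,
meant for `0 < u < 1`. -/
def Q {p q : ℕ} (A a : Fin p → ℝ) (B b : Fin q → ℝ) (u : ℝ) : ℝ :=
  (∑ i, u ^ (a i / A i) / (1 - u ^ (1 / A i))) - ∑ j, u ^ (b j / B j) / (1 - u ^ (1 / B j))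

end FoxH

end

/-!
Normalise the gamma ratio to `G s = gammaRatio s * ρ ^ (-s)`. Since `μ = 0` and `Δ = 0`, Binet's
formula for each Gamma factor gives `G = ν exp (L k)` on a right half plane, where `L` is the
Laplace transform and `k t = Q (exp (-t)) / t`. The linear Volterra equation
`t h t = ν t k t + ∫ w in 0..t, h w * ((t - w) k (t - w))` is the time-domain form of
`G' = (L k)' G`, so that its solution `h` satisfies `ν + L h = G`.

By the reflection formula and the Phragmén-Lindelöf principle `G` is bounded away from the real
axis, which allows the left loop to be opened to a vertical line. Laplace inversion there, made
absolutely convergent by dividing `G` by `s ^ 2` and then differentiating twice in `t`, yields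
`H x = h (log (ρ / x))`. The substitution `w = log (ρ / u)` turns the Volterra equation for `h` into
the integral equation for `H`.
-/

open MeasureTheory Filter Topology Set
open scoped FourierTransform

namespace FoxH

/-! ### The Laplace transform -/

/-- The class of functions that are continuous on `(0, ∞)` and `O(exp (m t))` there: their Laplace
transforms converge absolutely on the half plane `re s > m`. -/
structure ExpBounded (m : ℝ) (f : ℝ → ℝ) : Prop where
  continuousOn : ContinuousOn f (Ioi 0)
  bound : ∃ C, 0 ≤ C ∧ ∀ t, 0 < t → |f t| ≤ C * Real.exp (m * t)

/-- The Laplace transform of a real function, as a function of a complex variable. -/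
noncomputable def laplace (f : ℝ → ℝ) (s : ℂ) : ℂ :=
  ∫ t in Ioi (0 : ℝ), (f t : ℂ) * Complex.exp (-s * t)

/-- The restriction of the Laplace transform to the real axis. -/
noncomputable def realLaplace (f : ℝ → ℝ) (x : ℝ) : ℝ :=
  ∫ t in Ioi (0 : ℝ), f t * Real.exp (-(x * t))

lemma laplace_ofReal (f : ℝ → ℝ) (x : ℝ) : laplace f x = (realLaplace f x : ℂ) := by
  rw [laplace, realLaplace, ← integral_complex_ofReal]
  congr 1
  ext t
  push_cast
  ring_nf

lemma realLaplace_congr {f g : ℝ → ℝ} (h : EqOn f g (Ioi 0)) (x : ℝ) :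
    realLaplace f x = realLaplace g x :=
  setIntegral_congr_fun measurableSet_Ioi fun t ht => by simp only [h ht]

lemma realLaplace_const_mul (c : ℝ) (f : ℝ → ℝ) (x : ℝ) :
    realLaplace (fun t => c * f t) x = c * realLaplace f x := by
  simp only [realLaplace, mul_assoc, integral_const_mul]

lemma realLaplace_exp_neg_mul (c : ℝ) (f : ℝ → ℝ) (x : ℝ) :
    realLaplace (fun t => Real.exp (-(c * t)) * f t) x = realLaplace f (x + c) := by
  rw [realLaplace, realLaplace]
  congr 1
  ext t
  rw [add_mul, neg_add, Real.exp_add]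
  ring

lemma realLaplace_comp_div {A : ℝ} (hA : 0 < A) (f : ℝ → ℝ) (x : ℝ) :
    realLaplace (fun t => A⁻¹ * f (t / A)) x = realLaplace f (A * x) := by
  have h := integral_comp_mul_left_Ioi
    (fun u => f u * Real.exp (-(A * x * u))) 0 (inv_pos.2 hA)
  have hcancel : ∀ t, A * x * (t / A) = x * t := fun t => by field_simp
  simp only [mul_zero, inv_inv, smul_eq_mul, ← div_eq_inv_mul, hcancel] at h
  rw [realLaplace_const_mul, realLaplace, realLaplace, h, inv_mul_cancel_left₀ hA.ne']

lemma norm_ofReal_mul_cexp (y t : ℝ) (s : ℂ) :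
    ‖(y : ℂ) * Complex.exp (-s * t)‖ = |y| * Real.exp (-s.re * t) := by
  rw [norm_mul, Complex.norm_real, Complex.norm_exp, Real.norm_eq_abs]
  simp

lemma integrableOn_exp_mul_Ioi_zero {b : ℝ} (hb : b < 0) (C : ℝ) :
    IntegrableOn (fun t : ℝ => C * Real.exp (b * t)) (Ioi 0) :=
  (integrableOn_exp_mul_Ioi hb 0).const_mul C

lemma realLaplace_exp_neg {c x : ℝ} (h : 0 < x + c) :
    realLaplace (fun t => Real.exp (-(c * t))) x = 1 / (x + c) := by
  have hone := realLaplace_exp_neg_mul c (fun _ => 1) x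
  simp only [mul_one] at hone
  rw [hone, realLaplace]
  simp only [one_mul, ← neg_mul]
  rw [integral_exp_mul_Ioi (by linarith), mul_zero, Real.exp_zero, neg_div_neg_eq]

lemma expBounded_exp_neg (c : ℝ) : ExpBounded (-c) (fun t => Real.exp (-(c * t))) :=
  ⟨by fun_prop, 1, zero_le_one, fun t _ => by
    rw [abs_of_pos (Real.exp_pos _), one_mul, neg_mul]⟩

namespace ExpBounded

variable {m m' : ℝ} {f g : ℝ → ℝ}

lemma mono (h : ExpBounded m f) (hm : m ≤ m') : ExpBounded m' f := by
  obtain ⟨C, hC0, hC⟩ := h.bound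
  exact ⟨h.continuousOn, C, hC0, fun t ht => (hC t ht).trans (by gcongr)⟩

lemma add (hf : ExpBounded m f) (hg : ExpBounded m g) : ExpBounded m (fun t => f t + g t) := by
  obtain ⟨C, hC0, hC⟩ := hf.bound
  obtain ⟨D, hD0, hD⟩ := hg.bound
  refine ⟨hf.continuousOn.add hg.continuousOn, C + D, by positivity,
    fun t ht => (abs_add_le _ _).trans ?_⟩
  rw [add_mul]
  exact add_le_add (hC t ht) (hD t ht)

lemma const_mul (c : ℝ) (hf : ExpBounded m f) : ExpBounded m (fun t => c * f t) := by
  obtain ⟨C, hC0, hC⟩ := hf.bound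
  refine ⟨continuousOn_const.mul hf.continuousOn, |c| * C, by positivity, fun t ht => ?_⟩
  rw [abs_mul, mul_assoc]
  exact mul_le_mul_of_nonneg_left (hC t ht) (abs_nonneg c)

lemma sub (hf : ExpBounded m f) (hg : ExpBounded m g) : ExpBounded m (fun t => f t - g t) := by
  simpa only [neg_one_mul, ← sub_eq_add_neg] using hf.add (hg.const_mul (-1))

lemma sum {ι : Type*} {S : Finset ι} {F : ι → ℝ → ℝ} (h : ∀ i ∈ S, ExpBounded m (F i)) :
    ExpBounded m (fun t => ∑ i ∈ S, F i t) := by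
  classical
  induction S using Finset.induction_on with
  | empty => exact ⟨by simpa using continuousOn_const, 0, le_rfl, fun t _ => by simp⟩
  | insert i S hi ih =>
    simp only [Finset.sum_insert hi]
    exact (h i (Finset.mem_insert_self i S)).add
      (ih fun j hj => h j (Finset.mem_insert_of_mem hj))

lemma exp_neg_mul (c : ℝ) (hf : ExpBounded m f) :
    ExpBounded (m - c) (fun t => Real.exp (-(c * t)) * f t) := by
  obtain ⟨C, hC0, hC⟩ := hf.bound
  refine ⟨ContinuousOn.mul (by fun_prop) hf.continuousOn, C, hC0, fun t ht => ?_⟩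
  rw [abs_mul, abs_of_pos (Real.exp_pos _), sub_eq_neg_add, add_mul, Real.exp_add, neg_mul,
    mul_left_comm]
  exact mul_le_mul_of_nonneg_left (hC t ht) (Real.exp_pos _).le

lemma comp_div (hf : ExpBounded m f) {A : ℝ} (hA : 0 < A) :
    ExpBounded (m / A) (fun t => f (t / A)) := by
  obtain ⟨C, hC0, hC⟩ := hf.bound
  refine ⟨hf.continuousOn.comp (by fun_prop) fun t ht => div_pos ht hA, C, hC0,
    fun t ht => (hC _ (div_pos ht hA)).trans_eq ?_⟩
  ring_nf

lemma id_mul (hf : ExpBounded m f) (hm : m < m') : ExpBounded m' (fun t => t * f t) := by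
  obtain ⟨C, hC0, hC⟩ := hf.bound
  have hd : 0 < m' - m := sub_pos.2 hm
  refine ⟨continuousOn_id.mul hf.continuousOn, C / (m' - m), by positivity, fun t ht => ?_⟩
  have hexp : (m' - m) * t ≤ Real.exp ((m' - m) * t) := by
    linarith [Real.add_one_le_exp ((m' - m) * t)]
  rw [abs_mul, abs_of_pos ht]
  calc t * |f t| ≤ t * (C * Real.exp (m * t)) := by gcongr; exact hC t ht
    _ = C / (m' - m) * ((m' - m) * t * Real.exp (m * t)) := by field_simp
    _ ≤ C / (m' - m) * (Real.exp ((m' - m) * t) * Real.exp (m * t)) := by gcongr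
    _ = C / (m' - m) * Real.exp (m' * t) := by rw [← Real.exp_add]; ring_nf

lemma exists_norm_laplaceIntegrand_le (hf : ExpBounded m f) :
    ∃ C, 0 ≤ C ∧ ∀ (r : ℝ) (s : ℂ) (t : ℝ), r ≤ s.re → 0 < t →
      ‖(f t : ℂ) * Complex.exp (-s * t)‖ ≤ C * Real.exp ((m - r) * t) := by
  obtain ⟨C, hC0, hC⟩ := hf.bound
  refine ⟨C, hC0, fun r s t hr ht => ?_⟩
  rw [norm_ofReal_mul_cexp]
  calc |f t| * Real.exp (-s.re * t) ≤ C * Real.exp (m * t) * Real.exp (-r * t) := by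
        gcongr
        exact hC t ht
    _ = C * Real.exp ((m - r) * t) := by rw [mul_assoc, ← Real.exp_add]; ring_nf

lemma aestronglyMeasurable_laplaceIntegrand (hf : ExpBounded m f) (s : ℂ) :
    AEStronglyMeasurable (fun t : ℝ => (f t : ℂ) * Complex.exp (-s * t))
      (volume.restrict (Ioi 0)) :=
  ((Complex.continuous_ofReal.comp_continuousOn hf.continuousOn).mul
    (by fun_prop)).aestronglyMeasurable measurableSet_Ioi

lemma integrableOn_laplaceIntegrand (hf : ExpBounded m f) {s : ℂ} (hs : m < s.re) :
    IntegrableOn (fun t : ℝ => (f t : ℂ) * Complex.exp (-s * t)) (Ioi 0) := by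
  obtain ⟨C, -, hC⟩ := hf.exists_norm_laplaceIntegrand_le
  refine (integrableOn_exp_mul_Ioi_zero (sub_neg.2 hs) C).mono'
    (hf.aestronglyMeasurable_laplaceIntegrand s) ?_
  filter_upwards [ae_restrict_mem measurableSet_Ioi] with t ht using hC s.re s t le_rfl ht

lemma integrableOn_realLaplaceIntegrand (hf : ExpBounded m f) {x : ℝ} (hx : m < x) :
    IntegrableOn (fun t : ℝ => f t * Real.exp (-(x * t))) (Ioi 0) := by
  refine (hf.integrableOn_laplaceIntegrand (s := x) hx).re.congr (ae_of_all _ fun t => ?_)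
  have hreal : (f t : ℂ) * Complex.exp (-(x : ℂ) * t)
      = ((f t * Real.exp (-(x * t)) : ℝ) : ℂ) := by
    push_cast
    ring_nf
  simp only [hreal, RCLike.re_to_complex, Complex.ofReal_re]

lemma exists_norm_laplace_le (hf : ExpBounded m f) :
    ∃ C, 0 ≤ C ∧ ∀ s : ℂ, m < s.re → ‖laplace f s‖ ≤ C / (s.re - m) := by
  obtain ⟨C, hC0, hC⟩ := hf.exists_norm_laplaceIntegrand_le
  refine ⟨C, hC0, fun s hs => ?_⟩
  have hinteg : ∫ t in Ioi (0 : ℝ), C * Real.exp ((m - s.re) * t) = C / (s.re - m) := by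
    rw [integral_const_mul, integral_exp_mul_Ioi (sub_neg.2 hs), mul_zero, Real.exp_zero,
      ← neg_sub, neg_div_neg_eq, mul_one_div]
  rw [← hinteg]
  refine norm_integral_le_of_norm_le (integrableOn_exp_mul_Ioi_zero (sub_neg.2 hs) C) ?_
  filter_upwards [ae_restrict_mem measurableSet_Ioi] with t ht using hC s.re s t le_rfl ht

lemma tendsto_realLaplace (hf : ExpBounded m f) : Tendsto (realLaplace f) atTop (𝓝 0) := by
  obtain ⟨C, -, hC⟩ := hf.exists_norm_laplace_le
  have hlim : Tendsto (fun x : ℝ => C / (x - m)) atTop (𝓝 0) :=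
    Tendsto.div_atTop tendsto_const_nhds (tendsto_atTop_add_const_right _ (-m) tendsto_id)
  refine squeeze_zero_norm' ?_ hlim
  filter_upwards [eventually_gt_atTop m] with x hx
  simpa only [laplace_ofReal, Complex.norm_real, Complex.ofReal_re] using hC x hx

lemma hasDerivAt_laplace (hf : ExpBounded m f) {s : ℂ} (hs : m < s.re) :
    HasDerivAt (laplace f) (-laplace (fun t => t * f t) s) s := by
  obtain ⟨m', hm, hm's⟩ := exists_between hs
  obtain ⟨r, hr, hrs⟩ := exists_between hm's
  obtain ⟨C, -, hC⟩ := (hf.id_mul hm).exists_norm_laplaceIntegrand_le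
  have hderiv : ∀ (t : ℝ) (z : ℂ), HasDerivAt (fun z : ℂ => (f t : ℂ) * Complex.exp (-z * t))
      (-(((t * f t : ℝ) : ℂ) * Complex.exp (-z * t))) z := fun t z => by
    refine (((hasDerivAt_neg' z).mul_const (t : ℂ)).cexp.const_mul (f t : ℂ)).congr_deriv ?_
    push_cast
    ring_nf
  have hhalf : {z : ℂ | r < z.re} ∈ 𝓝 s :=
    (isOpen_lt continuous_const Complex.continuous_re).mem_nhds hrs
  have h := (hasDerivAt_integral_of_dominated_loc_of_deriv_le
    (bound := fun t => C * Real.exp ((m' - r) * t)) hhalf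
    (Eventually.of_forall hf.aestronglyMeasurable_laplaceIntegrand)
    (hf.integrableOn_laplaceIntegrand hs)
    ((hf.id_mul hm).aestronglyMeasurable_laplaceIntegrand s).neg
    (by
      filter_upwards [ae_restrict_mem measurableSet_Ioi] with t ht z hz
      simpa only [norm_neg] using hC r z t (le_of_lt hz) ht)
    (integrableOn_exp_mul_Ioi_zero (sub_neg.2 hr) C)
    (ae_of_all _ fun t z _ => hderiv t z)).2
  rwa [integral_neg] at h

lemma hasDerivAt_realLaplace (hf : ExpBounded m f) {x : ℝ} (hx : m < x) :
    HasDerivAt (realLaplace f) (-realLaplace (fun t => t * f t) x) x := by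
  have h := (hf.hasDerivAt_laplace (s := x) hx).real_of_complex
  simpa only [laplace_ofReal, ← Complex.ofReal_neg, Complex.ofReal_re] using h

lemma laplace_add (hf : ExpBounded m f) (hg : ExpBounded m g) {s : ℂ} (hs : m < s.re) :
    laplace (fun t => f t + g t) s = laplace f s + laplace g s := by
  simp only [laplace, Complex.ofReal_add, add_mul]
  exact integral_add (hf.integrableOn_laplaceIntegrand hs) (hg.integrableOn_laplaceIntegrand hs)

lemma realLaplace_add (hf : ExpBounded m f) (hg : ExpBounded m g) {x : ℝ} (hx : m < x) :
    realLaplace (fun t => f t + g t) x = realLaplace f x + realLaplace g x := by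
  have h := hf.laplace_add hg (s := x) hx
  rw [laplace_ofReal, laplace_ofReal, laplace_ofReal] at h
  exact_mod_cast h

lemma realLaplace_sub (hf : ExpBounded m f) (hg : ExpBounded m g) {x : ℝ} (hx : m < x) :
    realLaplace (fun t => f t - g t) x = realLaplace f x - realLaplace g x := by
  simp only [realLaplace, sub_mul]
  exact integral_sub (hf.integrableOn_realLaplaceIntegrand hx)
    (hg.integrableOn_realLaplaceIntegrand hx)

lemma realLaplace_sum {ι : Type*} {S : Finset ι} {F : ι → ℝ → ℝ}
    (h : ∀ i ∈ S, ExpBounded m (F i)) {x : ℝ} (hx : m < x) :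
    realLaplace (fun t => ∑ i ∈ S, F i t) x = ∑ i ∈ S, realLaplace (F i) x := by
  simp only [realLaplace, Finset.sum_mul]
  exact integral_finsetSum _ fun i hi => (h i hi).integrableOn_realLaplaceIntegrand hx

lemma laplace_convolution (hf : ExpBounded m f) (hg : ExpBounded m g) {s : ℂ}
    (hs : m < s.re) :
    laplace (fun t => ∫ w in (0 : ℝ)..t, f w * g (t - w)) s = laplace f s * laplace g s := by
  have h := integral_posConvolution (hf.integrableOn_laplaceIntegrand hs)
    (hg.integrableOn_laplaceIntegrand hs) (ContinuousLinearMap.mul ℝ ℂ)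
  simp only [ContinuousLinearMap.mul_apply'] at h
  rw [laplace, laplace, laplace, ← h]
  congr 1
  ext t
  rw [← intervalIntegral.integral_ofReal, ← intervalIntegral.integral_mul_const]
  congr 1
  ext w
  push_cast
  rw [show -s * (t : ℂ) = -s * w + -s * (t - w) by ring, Complex.exp_add]
  ring

lemma realLaplace_convolution (hf : ExpBounded m f) (hg : ExpBounded m g) {x : ℝ}
    (hx : m < x) :
    realLaplace (fun t => ∫ w in (0 : ℝ)..t, f w * g (t - w)) x
      = realLaplace f x * realLaplace g x := by
  have h := hf.laplace_convolution hg (s := x) hx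
  rw [laplace_ofReal, laplace_ofReal, laplace_ofReal] at h
  exact_mod_cast h

end ExpBounded

lemma eq_of_hasDerivAt_of_tendsto {E : Type*} [NormedAddCommGroup E] [NormedSpace ℝ E]
    {m : ℝ} {l : E} {F G F' : ℝ → E}
    (hF : ∀ x, m < x → HasDerivAt F (F' x) x) (hG : ∀ x, m < x → HasDerivAt G (F' x) x)
    (hFl : Tendsto F atTop (𝓝 l)) (hGl : Tendsto G atTop (𝓝 l)) {x : ℝ} (hx : m < x) :
    F x = G x := by
  obtain ⟨c, hc⟩ := isOpen_Ioi.exists_eq_add_of_deriv_eq isPreconnected_Ioi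
    (fun y hy => (hF y hy).differentiableAt.differentiableWithinAt)
    (fun y hy => (hG y hy).differentiableAt.differentiableWithinAt)
    (fun y hy => by rw [(hF y hy).deriv, (hG y hy).deriv])
  have hlim : Tendsto F atTop (𝓝 (l + c)) := (hGl.add_const c).congr' <| by
    filter_upwards [eventually_gt_atTop m] with y hy using (hc hy).symm
  have hc0 : c = 0 := by simpa using tendsto_nhds_unique hFl hlim
  simp only [hc hx, hc0, add_zero]

/-! ### Binet's formula -/

lemma analyticAt_dslope {𝕜 E : Type*} [NontriviallyNormedField 𝕜] [NormedAddCommGroup E]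
    [NormedSpace 𝕜 E] {f : 𝕜 → E} {x₀ x : 𝕜} (h₀ : AnalyticAt 𝕜 f x₀) (hx : AnalyticAt 𝕜 f x) :
    AnalyticAt 𝕜 (dslope f x₀) x := by
  rcases eq_or_ne x x₀ with rfl | hne
  · obtain ⟨p, hp⟩ := h₀
    exact ⟨_, hp.has_fpower_series_dslope_fslope⟩
  · have hquot : AnalyticAt 𝕜 (fun y => (y - x₀)⁻¹ • (f y - f x₀)) x :=
      ((analyticAt_id.sub analyticAt_const).inv (sub_ne_zero.2 hne)).smul (hx.sub analyticAt_const)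
    refine hquot.congr ?_
    filter_upwards [isOpen_ne.mem_nhds hne] with y hy
    rw [dslope_of_ne _ hy, slope_def_module]

/-- The entire function `(exp u - 1) / u`. -/
noncomputable def expQuot : ℝ → ℝ := dslope Real.exp 0

lemma expQuot_of_ne {u : ℝ} (hu : u ≠ 0) : expQuot u = (Real.exp u - 1) / u := by
  rw [expQuot, dslope_of_ne _ hu, slope_def_field, sub_zero, Real.exp_zero]

lemma expQuot_zero : expQuot 0 = 1 := by
  rw [expQuot, dslope_same, Real.deriv_exp, Real.exp_zero]

lemma expQuot_pos (u : ℝ) : 0 < expQuot u := by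
  rcases lt_trichotomy u 0 with hu | rfl | hu
  · rw [expQuot_of_ne hu.ne]
    exact div_pos_of_neg_of_neg (by simpa using hu) hu
  · rw [expQuot_zero]
    exact one_pos
  · rw [expQuot_of_ne hu.ne']
    exact div_pos (by simpa using hu) hu

lemma mul_expQuot_neg {t : ℝ} (ht : t ≠ 0) : t * expQuot (-t) = 1 - Real.exp (-t) := by
  rw [expQuot_of_ne (neg_ne_zero.2 ht)]
  field_simp
  ring

lemma one_sub_exp_neg_ne_zero {t : ℝ} (ht : t ≠ 0) : 1 - Real.exp (-t) ≠ 0 := by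
  rw [← mul_expQuot_neg ht]
  exact mul_ne_zero ht (expQuot_pos _).ne'

lemma analyticAt_expQuot (u : ℝ) : AnalyticAt ℝ expQuot u :=
  analyticAt_dslope analyticAt_rexp analyticAt_rexp

lemma hasDerivAt_expQuot_zero : HasDerivAt expQuot (1 / 2) 0 := by
  have hexp : HasFPowerSeriesAt Real.exp (NormedSpace.expSeries ℝ ℝ) 0 := by
    rw [Real.exp_eq_exp_ℝ]
    exact NormedSpace.exp_hasFPowerSeriesAt_zero
  have h := hexp.has_fpower_series_dslope_fslope.hasDerivAt
  rwa [show (NormedSpace.expSeries ℝ ℝ).fslope 1 (fun _ => 1) = 1 / 2 by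
    change (NormedSpace.expSeries ℝ ℝ).fslope.coeff 1 = _
    rw [FormalMultilinearSeries.coeff_fslope]
    change NormedSpace.expSeries ℝ ℝ 2 (fun _ => 1) = _
    rw [NormedSpace.expSeries_apply_eq]
    norm_num [Nat.factorial]] at h

/-- The generating function `u exp (-a u) / (1 - exp (-u))` of the Bernoulli polynomials in
`1 - a`, extended analytically to `u = 0`. -/
noncomputable def bernoulliGen (a u : ℝ) : ℝ := Real.exp (-(a * u)) / expQuot (-u)

lemma bernoulliGen_of_ne (a : ℝ) {u : ℝ} (hu : u ≠ 0) :
    bernoulliGen a u = u * (Real.exp (-(a * u)) / (1 - Real.exp (-u))) := by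
  rw [bernoulliGen, ← mul_expQuot_neg hu, ← mul_div_assoc, mul_div_mul_left _ _ hu]

lemma bernoulliGen_zero (a : ℝ) : bernoulliGen a 0 = 1 := by
  simp [bernoulliGen, expQuot_zero]

lemma analyticAt_bernoulliGen (a u : ℝ) : AnalyticAt ℝ (bernoulliGen a) u :=
  AnalyticAt.div (by fun_prop) ((analyticAt_expQuot (-u)).comp analyticAt_id.neg)
    (expQuot_pos _).ne'

lemma deriv_bernoulliGen_zero (a : ℝ) : deriv (bernoulliGen a) 0 = 1 / 2 - a := by
  have hnum : HasDerivAt (fun u : ℝ => Real.exp (-(a * u))) (-a) 0 := by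
    simpa using ((hasDerivAt_id (0 : ℝ)).const_mul a).fun_neg.exp
  have hden : HasDerivAt (fun u : ℝ => expQuot (-u)) (-(1 / 2)) 0 := by
    simpa [Function.comp_def] using
      hasDerivAt_expQuot_zero.comp_of_eq (0 : ℝ) (hasDerivAt_neg' 0) neg_zero.symm
  rw [show bernoulliGen a = fun u => Real.exp (-(a * u)) / expQuot (-u) from rfl,
    (hnum.fun_div hden (expQuot_pos _).ne').deriv, mul_zero, neg_zero, Real.exp_zero,
    expQuot_zero]
  ring

/-- The kernel `(exp (-a u) / (1 - exp (-u)) - 1 / u - (1 / 2 - a)) / u` of Binet's formula for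
`log Γ (z + a)`, extended analytically to `u = 0`. -/
noncomputable def binetKernel (a : ℝ) : ℝ → ℝ := dslope (dslope (bernoulliGen a) 0) 0

lemma continuous_binetKernel (a : ℝ) : Continuous (binetKernel a) :=
  continuous_iff_continuousAt.2 fun x =>
    have hslope : ∀ y, AnalyticAt ℝ (dslope (bernoulliGen a) 0) y := fun y =>
      analyticAt_dslope (analyticAt_bernoulliGen a 0) (analyticAt_bernoulliGen a y)
    (analyticAt_dslope (hslope 0) (hslope x)).continuousAt

lemma binetKernel_of_ne (a : ℝ) {u : ℝ} (hu : u ≠ 0) :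
    binetKernel a u
      = (Real.exp (-(a * u)) / (1 - Real.exp (-u)) - 1 / u - (1 / 2 - a)) / u := by
  rw [binetKernel, dslope_of_ne _ hu, slope_def_field, dslope_of_ne _ hu, slope_def_field,
    dslope_same, deriv_bernoulliGen_zero, bernoulliGen_of_ne a hu, bernoulliGen_zero, sub_zero]
  field_simp

lemma abs_binetKernel_le (a : ℝ) {t : ℝ} (ht : 1 ≤ t) :
    |binetKernel a t| ≤ (1 / (1 - Real.exp (-1)) + 1 + |1 / 2 - a|) * Real.exp (|a| * t) := by
  have ht0 : 0 < t := one_pos.trans_le ht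
  have hone : 1 ≤ Real.exp (|a| * t) := Real.one_le_exp (by positivity)
  have hgap : 0 < 1 - Real.exp (-1) := sub_pos.2 (by simp)
  have hexp : |Real.exp (-(a * t)) / (1 - Real.exp (-t))|
      ≤ 1 / (1 - Real.exp (-1)) * Real.exp (|a| * t) := by
    have hgap' : 1 - Real.exp (-1) ≤ 1 - Real.exp (-t) := by gcongr
    have hat : -(a * t) ≤ |a| * t := by
      rw [← neg_mul]
      gcongr
      exact neg_le_abs a
    rw [abs_div, Real.abs_exp, abs_of_pos (hgap.trans_le hgap'), one_div, ← div_eq_inv_mul]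
    gcongr
  have hinv : |1 / t| ≤ 1 := by
    rw [abs_of_pos (by positivity)]
    exact (div_le_one ht0).2 ht
  rw [binetKernel_of_ne a ht0.ne', abs_div, abs_of_pos ht0]
  calc |Real.exp (-(a * t)) / (1 - Real.exp (-t)) - 1 / t - (1 / 2 - a)| / t
      ≤ |Real.exp (-(a * t)) / (1 - Real.exp (-t)) - 1 / t - (1 / 2 - a)| :=
        div_le_self (abs_nonneg _) ht
    _ ≤ |Real.exp (-(a * t)) / (1 - Real.exp (-t))| + |1 / t| + |1 / 2 - a| :=
        (abs_sub _ _).trans (by gcongr; exact abs_sub _ _)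
    _ ≤ 1 / (1 - Real.exp (-1)) * Real.exp (|a| * t) + Real.exp (|a| * t)
          + |1 / 2 - a| * Real.exp (|a| * t) := by
        gcongr
        · exact hinv.trans hone
        · exact le_mul_of_one_le_right (abs_nonneg _) hone
    _ = _ := by ring

lemma expBounded_binetKernel (a : ℝ) : ExpBounded |a| (binetKernel a) := by
  obtain ⟨M, hM⟩ := isCompact_Icc.exists_bound_of_continuousOn (s := Icc (0 : ℝ) 1)
    (continuous_binetKernel a).continuousOn
  refine ⟨(continuous_binetKernel a).continuousOn,
    max M (1 / (1 - Real.exp (-1)) + 1 + |1 / 2 - a|),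
    le_max_of_le_left ((norm_nonneg _).trans (hM 0 (by simp))), fun t ht => ?_⟩
  rcases le_total t 1 with h | h
  · exact ((hM t ⟨ht.le, h⟩).trans (le_max_left _ _)).trans
      (le_mul_of_one_le_right (le_max_of_le_left ((norm_nonneg _).trans (hM 0 (by simp))))
        (Real.one_le_exp (by positivity)))
  · refine (abs_binetKernel_le a h).trans ?_
    gcongr
    exact le_max_right _ _

lemma expBounded_expQuot_neg : ExpBounded 0 (fun t => expQuot (-t)) := by
  have hcont : Continuous expQuot :=
    continuous_iff_continuousAt.2 fun x => (analyticAt_expQuot x).continuousAt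
  refine ⟨(hcont.comp continuous_neg).continuousOn, 1, zero_le_one, fun t ht => ?_⟩
  rw [abs_of_pos (expQuot_pos _), zero_mul, Real.exp_zero, mul_one,
    ← mul_le_mul_iff_right₀ ht, mul_expQuot_neg ht.ne', mul_one]
  linarith [Real.add_one_le_exp (-t)]

lemma hasDerivAt_log_add_const {c x : ℝ} (h : 0 < x + c) :
    HasDerivAt (fun x => Real.log (x + c)) (1 / (x + c)) x :=
  ((hasDerivAt_id x).add_const c).log h.ne'

lemma realLaplace_expQuot_neg {x : ℝ} (hx : 0 < x) :
    realLaplace (fun t => expQuot (-t)) x = Real.log (x + 1) - Real.log x := by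
  have hderiv : ∀ y, 0 < y →
      -realLaplace (fun t => t * expQuot (-t)) y = 1 / (y + 1) - 1 / y := by
    intro y hy
    have hexp : EqOn (fun t => t * expQuot (-t))
        (fun t => Real.exp (-(0 * t)) - Real.exp (-(1 * t))) (Ioi 0) := fun t ht => by
      simp only [mul_expQuot_neg (ne_of_gt ht), zero_mul, neg_zero, Real.exp_zero, one_mul]
    rw [realLaplace_congr hexp, ((expBounded_exp_neg 0).mono neg_zero.le).realLaplace_sub
      ((expBounded_exp_neg 1).mono (by norm_num)) hy, realLaplace_exp_neg (by linarith),
      realLaplace_exp_neg (by linarith), add_zero, neg_sub]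
  refine eq_of_hasDerivAt_of_tendsto (m := 0)
    (fun y hy => expBounded_expQuot_neg.hasDerivAt_realLaplace hy) (fun y hy => ?_)
    expBounded_expQuot_neg.tendsto_realLaplace (Real.tendsto_log_comp_add_sub_log 1) hx
  rw [hderiv y hy]
  refine (hasDerivAt_log_add_const (by linarith)).fun_sub ?_
  simpa only [one_div] using Real.hasDerivAt_log hy.ne'

/-- The main term of Stirling's formula for `log Γ (z + a)`. -/
noncomputable def stirlingMain (a z : ℝ) : ℝ :=
  (z + a - 1 / 2) * Real.log z - z + 1 / 2 * Real.log (2 * Real.pi)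

lemma hasDerivAt_stirlingMain (a : ℝ) {z : ℝ} (hz : z ≠ 0) :
    HasDerivAt (stirlingMain a) (Real.log z + (a - 1 / 2) / z) z := by
  have hlin : HasDerivAt (fun z : ℝ => z + a - 1 / 2) 1 z :=
    ((hasDerivAt_id z).add_const a).sub_const (1 / 2)
  refine (((hlin.fun_mul (Real.hasDerivAt_log hz)).fun_sub (hasDerivAt_id z)).add_const
    (1 / 2 * Real.log (2 * Real.pi))).congr_deriv ?_
  field_simp
  ring

lemma tendsto_mul_log_add_sub_log (c : ℝ) :
    Tendsto (fun x : ℝ => x * (Real.log (x + c) - Real.log x)) atTop (𝓝 c) := by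
  refine (Real.tendsto_mul_log_one_add_div_atTop c).congr' ?_
  filter_upwards [eventually_gt_atTop 0, eventually_gt_atTop (-c)] with x hx hxc
  rw [← Real.log_div (by linarith) hx.ne']
  congr 2
  field_simp

lemma tendsto_stirlingMain_sub (a : ℝ) :
    Tendsto (fun x => -Real.log (x + a) + stirlingMain a (x + 1) - stirlingMain a x) atTop
      (𝓝 0) := by
  have h := (((Real.tendsto_log_comp_add_sub_log a).neg.add
    ((Real.tendsto_log_comp_add_sub_log 1).const_mul (a + 1 / 2))).add
    (tendsto_mul_log_add_sub_log 1)).sub_const 1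
  rw [show -0 + (a + 1 / 2) * 0 + 1 - (1 : ℝ) = 0 by ring] at h
  refine h.congr fun x => ?_
  simp only [stirlingMain]
  ring

lemma realLaplace_id_mul_binetKernel_sub {a y : ℝ} (hy : |a| < y) :
    realLaplace (fun t => t * (binetKernel a t - Real.exp (-(1 * t)) * binetKernel a t)) y
      = 1 / (y + a) - ((Real.log (y + 1) - Real.log y)
        + (1 / 2 - a) * (1 / y - 1 / (y + 1))) := by
  have ha := neg_abs_le a
  have ha0 := abs_nonneg a
  have hexp : EqOn (fun t => t * (binetKernel a t - Real.exp (-(1 * t)) * binetKernel a t))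
      (fun t => Real.exp (-(a * t)) -
        (expQuot (-t) + (1 / 2 - a) * (Real.exp (-(0 * t)) - Real.exp (-(1 * t)))))
      (Ioi 0) := fun t ht => by
    have ht : t ≠ 0 := ne_of_gt ht
    have hne := one_sub_exp_neg_ne_zero ht
    simp only [binetKernel_of_ne a ht, expQuot_of_ne (neg_ne_zero.2 ht), zero_mul, one_mul,
      neg_zero, Real.exp_zero]
    field_simp
    ring
  have b0 : ExpBounded |a| _ := (expBounded_exp_neg 0).mono (by simp)
  have b1 : ExpBounded |a| _ := (expBounded_exp_neg 1).mono (by linarith)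
  have ba : ExpBounded |a| _ := (expBounded_exp_neg a).mono (by linarith)
  have bq : ExpBounded |a| _ := expBounded_expQuot_neg.mono ha0
  rw [realLaplace_congr hexp, ba.realLaplace_sub (bq.add ((b0.sub b1).const_mul _)) hy,
    bq.realLaplace_add ((b0.sub b1).const_mul _) hy, realLaplace_const_mul,
    b0.realLaplace_sub b1 hy, realLaplace_exp_neg (by linarith),
    realLaplace_exp_neg (by linarith), realLaplace_exp_neg (by linarith),
    realLaplace_expQuot_neg (by linarith), add_zero]

lemma realLaplace_binetKernel_sub {a z : ℝ} (hz : |a| < z) :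
    realLaplace (binetKernel a) z - realLaplace (binetKernel a) (z + 1)
      = -Real.log (z + a) + stirlingMain a (z + 1) - stirlingMain a z := by
  have hb := expBounded_binetKernel a
  have hb1 : ExpBounded |a| _ := (hb.exp_neg_mul 1).mono (by linarith)
  rw [← realLaplace_exp_neg_mul 1, ← hb.realLaplace_sub hb1 hz]
  refine eq_of_hasDerivAt_of_tendsto (m := |a|)
    (fun y hy => (hb.sub hb1).hasDerivAt_realLaplace hy) (fun y hy => ?_)
    (hb.sub hb1).tendsto_realLaplace (tendsto_stirlingMain_sub a) hz
  have hy0 : 0 < y := (abs_nonneg a).trans_lt hy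
  have hya : 0 < y + a := by linarith [neg_abs_le a]
  have hstep := (hasDerivAt_stirlingMain a (add_pos hy0 one_pos).ne').comp_add_const y 1
  rw [realLaplace_id_mul_binetKernel_sub hy]
  refine (((hasDerivAt_log_add_const hya).fun_neg.fun_add hstep).fun_sub
    (hasDerivAt_stirlingMain a hy0.ne')).congr_deriv ?_
  ring

lemma log_Gamma_add_natCast {w : ℝ} (hw : 0 < w) (n : ℕ) :
    Real.log (Real.Gamma (w + n))
      = Real.log (Real.Gamma w) + ∑ m ∈ Finset.range n, Real.log (w + m) :=
  Real.BohrMollerup.f_add_nat_eq (f := Real.log ∘ Real.Gamma) (fun {y} hy => by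
    simp only [Function.comp_apply]
    rw [Real.Gamma_add_one hy.ne', Real.log_mul hy.ne' (Real.Gamma_pos_of_pos hy).ne', add_comm])
    hw n

lemma tendsto_log_stirlingSeq :
    Tendsto (fun n => Real.log (Stirling.stirlingSeq n)) atTop (𝓝 (Real.log (√Real.pi))) :=
  (Real.continuousAt_log (Real.sqrt_pos.2 Real.pi_pos).ne').tendsto.comp
    Stirling.tendsto_stirlingSeq_sqrt_pi

lemma tendsto_log_Gamma_sub_stirlingMain {a z : ℝ} (hz : 0 < z + a) :
    Tendsto (fun n : ℕ => Real.log (Real.Gamma (z + (n + 1 : ℕ) + a))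
      - stirlingMain a (z + (n + 1 : ℕ))) atTop (𝓝 0) := by
  have hcast := tendsto_natCast_atTop_atTop (R := ℝ)
  have h := (((Real.BohrMollerup.tendsto_log_gamma hz).const_sub
    (Real.log (Real.Gamma (z + a)))).add
    (tendsto_log_stirlingSeq.sub_const (Real.log (√Real.pi)))).sub
    (((tendsto_mul_log_add_sub_log (z + 1)).comp hcast).sub_const (z + 1)) |>.sub
    (((Real.tendsto_log_comp_add_sub_log (z + 1)).comp hcast).const_mul (z + a + 1 / 2))
  simp only [sub_self, mul_zero, add_zero] at h
  refine h.congr' ?_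
  filter_upwards [eventually_gt_atTop 0] with n hn
  have hn' : (0 : ℝ) < n := by exact_mod_cast hn
  rw [show z + (n + 1 : ℕ) + a = z + a + (n + 1 : ℕ) by ring, log_Gamma_add_natCast hz,
    Stirling.log_stirlingSeq_formula, Real.BohrMollerup.logGammaSeq, stirlingMain,
    Real.log_div hn'.ne' (Real.exp_pos 1).ne', Real.log_exp, Real.log_mul two_ne_zero hn'.ne',
    Real.log_mul two_ne_zero Real.pi_pos.ne', Real.log_sqrt Real.pi_pos.le]
  simp only [Function.comp_apply]
  push_cast
  rw [show z + ((n : ℝ) + 1) = n + (z + 1) by ring]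
  ring

lemma log_Gamma_add_eq_stirlingMain_add_realLaplace {a z : ℝ} (hz : |a| < z) :
    Real.log (Real.Gamma (z + a)) = stirlingMain a z + realLaplace (binetKernel a) z := by
  set w : ℝ → ℝ := fun z => Real.log (Real.Gamma (z + a)) - stirlingMain a z
    - realLaplace (binetKernel a) z with hw
  have hperiod : ∀ y, |a| < y → w (y + 1) = w y := by
    intro y hy
    have hya : 0 < y + a := by linarith [neg_abs_le a]
    simp only [hw]
    rw [add_right_comm, Real.Gamma_add_one hya.ne',
      Real.log_mul hya.ne' (Real.Gamma_pos_of_pos hya).ne']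
    linarith [realLaplace_binetKernel_sub hy]
  have hconst : ∀ n : ℕ, w (z + n) = w z := by
    intro n
    induction n with
    | zero => simp
    | succ n ih =>
      rw [← ih, ← hperiod (z + n) (hz.trans_le (le_add_of_nonneg_right n.cast_nonneg)),
        Nat.cast_add_one, add_assoc]
  have hlim : Tendsto (fun n : ℕ => w (z + (n + 1 : ℕ))) atTop (𝓝 (0 - 0)) :=
    (tendsto_log_Gamma_sub_stirlingMain (by linarith [neg_abs_le a])).sub
      ((expBounded_binetKernel a).tendsto_realLaplace.comp <| tendsto_atTop_add_const_left _ _ <|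
        tendsto_natCast_atTop_atTop.comp (tendsto_add_atTop_nat 1))
  simp only [hconst, sub_zero] at hlim
  linarith [tendsto_nhds_unique tendsto_const_nhds hlim]

/-! ### Products of gamma functions -/

section GammaFamily

variable {ι : Type*} [Fintype ι] {A a : ι → ℝ}

/-- The product `∏ₖ Γ(Aₖ s + aₖ)`. -/
noncomputable def gammaProd (A a : ι → ℝ) (s : ℂ) : ℂ :=
  ∏ k, Complex.Gamma ((A k : ℂ) * s + (a k : ℂ))

/-- The function whose Laplace transform is the remainder in Stirling's formula for
`log ∏ₖ Γ(Aₖ s + aₖ)`. -/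
noncomputable def binetSum (A a : ι → ℝ) (t : ℝ) : ℝ :=
  ∑ k, (A k)⁻¹ * binetKernel (a k) (t / A k)

/-- An exponential order of growth of `binetSum A a`. -/
noncomputable def growthRate (A a : ι → ℝ) : ℝ := ∑ k, |a k| / A k

lemma growthRate_nonneg (hA : ∀ k, 0 < A k) : 0 ≤ growthRate A a :=
  Finset.sum_nonneg fun k _ => div_nonneg (abs_nonneg _) (hA k).le

lemma abs_div_le_growthRate (hA : ∀ k, 0 < A k) (k : ι) : |a k| / A k ≤ growthRate A a :=
  Finset.single_le_sum (f := fun k => |a k| / A k)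
    (fun k _ => div_nonneg (abs_nonneg _) (hA k).le) (Finset.mem_univ k)

lemma abs_lt_mul_of_growthRate_lt (hA : ∀ k, 0 < A k) {s : ℝ} (hs : growthRate A a < s) (k : ι) :
    |a k| < A k * s :=
  (div_lt_iff₀' (hA k)).1 ((abs_div_le_growthRate hA k).trans_lt hs)

lemma continuous_binetSum (A a : ι → ℝ) : Continuous (binetSum A a) :=
  continuous_finsetSum _ fun k _ => continuous_const.mul
    ((continuous_binetKernel (a k)).comp (continuous_id.div_const _))

lemma expBounded_binetSum_summand (hA : ∀ k, 0 < A k) (k : ι) :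
    ExpBounded (growthRate A a) (fun t => (A k)⁻¹ * binetKernel (a k) (t / A k)) :=
  (((expBounded_binetKernel (a k)).comp_div (hA k)).const_mul _).mono
    (abs_div_le_growthRate hA k)

lemma expBounded_binetSum (hA : ∀ k, 0 < A k) : ExpBounded (growthRate A a) (binetSum A a) :=
  ExpBounded.sum fun k _ => expBounded_binetSum_summand hA k

lemma realLaplace_binetSum (hA : ∀ k, 0 < A k) {s : ℝ} (hs : growthRate A a < s) :
    realLaplace (binetSum A a) s = ∑ k, realLaplace (binetKernel (a k)) (A k * s) :=
  (ExpBounded.realLaplace_sum (fun k _ => expBounded_binetSum_summand hA k) hs).trans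
    (Finset.sum_congr rfl fun k _ => realLaplace_comp_div (hA k) _ s)

lemma mul_binetSum (hA : ∀ k, 0 < A k) {t : ℝ} (ht : 0 < t) :
    t * binetSum A a t
      = ∑ k, Real.exp (-t) ^ (a k / A k) / (1 - Real.exp (-t) ^ (1 / A k))
        - (∑ k, A k) / t + (∑ k, a k - Fintype.card ι / 2) := by
  have hsummand : ∀ k, t * ((A k)⁻¹ * binetKernel (a k) (t / A k)) =
      Real.exp (-t) ^ (a k / A k) / (1 - Real.exp (-t) ^ (1 / A k)) - A k / t
        + (a k - 1 / 2) := fun k => by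
    have hAk := (hA k).ne'
    have htA : t / A k ≠ 0 := div_ne_zero ht.ne' hAk
    rw [binetKernel_of_ne _ htA, ← Real.exp_mul, ← Real.exp_mul,
      show -t * (a k / A k) = -(a k * (t / A k)) by ring,
      show -t * (1 / A k) = -(t / A k) by ring]
    field_simp
    ring
  rw [binetSum, Finset.mul_sum, Finset.sum_congr rfl fun k _ => hsummand k]
  simp only [Finset.sum_add_distrib, Finset.sum_sub_distrib, Finset.sum_div, Finset.sum_const,
    Finset.card_univ, nsmul_eq_mul]
  ring

lemma sum_stirlingMain (hA : ∀ k, 0 < A k) {s : ℝ} (hs : 0 < s) :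
    ∑ k, stirlingMain (a k) (A k * s)
      = s * ∑ k, A k * Real.log (A k) + ∑ k, (a k - 1 / 2) * Real.log (A k)
        + (s * ∑ k, A k + ∑ k, a k - Fintype.card ι / 2) * Real.log s - s * ∑ k, A k
        + Fintype.card ι / 2 * Real.log (2 * Real.pi) := by
  have hsummand : ∀ k, stirlingMain (a k) (A k * s) =
      s * (A k * Real.log (A k)) + (a k - 1 / 2) * Real.log (A k)
        + (s * A k + a k - 1 / 2) * Real.log s - s * A k
        + 1 / 2 * Real.log (2 * Real.pi) := fun k => by
    rw [stirlingMain, Real.log_mul (hA k).ne' hs.ne']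
    ring
  rw [Finset.sum_congr rfl fun k _ => hsummand k]
  simp only [Finset.sum_add_distrib, Finset.sum_sub_distrib, ← Finset.mul_sum, ← Finset.sum_mul,
    Finset.sum_const, Finset.card_univ, nsmul_eq_mul]
  ring

lemma gammaProd_ofReal (hA : ∀ k, 0 < A k) {s : ℝ} (hs : growthRate A a < s) :
    gammaProd A a s = (Real.exp (∑ k, stirlingMain (a k) (A k * s)
      + realLaplace (binetSum A a) s) : ℝ) := by
  have hfactor : ∀ k, Real.Gamma (A k * s + a k)
      = Real.exp (stirlingMain (a k) (A k * s) + realLaplace (binetKernel (a k)) (A k * s)) := by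
    intro k
    have hk := abs_lt_mul_of_growthRate_lt hA hs k
    have hpos : 0 < A k * s + a k := by linarith [neg_abs_le (a k)]
    rw [← log_Gamma_add_eq_stirlingMain_add_realLaplace hk,
      Real.exp_log (Real.Gamma_pos_of_pos hpos)]
  rw [realLaplace_binetSum hA hs, ← Finset.sum_add_distrib, Real.exp_sum, gammaProd]
  push_cast [← hfactor, ← Complex.Gamma_ofReal]
  rfl

end GammaFamily

section Balanced

variable {p q : ℕ} {A a : Fin p → ℝ} {B b : Fin q → ℝ}

/-- The parameters of Fox's function in the balanced case `Δ = 0`, `μ = 0`. -/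
structure IsBalanced (A a : Fin p → ℝ) (B b : Fin q → ℝ) : Prop where
  pos_left : ∀ k, 0 < A k
  pos_right : ∀ j, 0 < B j
  mu_eq_zero : mu a b = 0
  sum_eq : ∑ j, B j = ∑ k, A k

/-- The function `Q (exp (-t)) / t`, extended continuously to `t = 0` for balanced parameters. -/
noncomputable def kernel (A a : Fin p → ℝ) (B b : Fin q → ℝ) (t : ℝ) : ℝ :=
  binetSum A a t - binetSum B b t

/-- An exponential order of growth of `kernel A a B b`. -/
noncomputable def kernelRate (A a : Fin p → ℝ) (B b : Fin q → ℝ) : ℝ :=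
  max (growthRate A a) (growthRate B b)

/-- The gamma ratio normalised by `ρ ^ (-s)`, which removes the exponential part of its
asymptotics for balanced parameters. -/
noncomputable def normRatio (A a : Fin p → ℝ) (B b : Fin q → ℝ) (s : ℂ) : ℂ :=
  gammaRatio A a B b s * (rho A B : ℂ) ^ (-s)

lemma gammaRatio_eq (A a : Fin p → ℝ) (B b : Fin q → ℝ) (s : ℂ) :
    gammaRatio A a B b s = gammaProd A a s / gammaProd B b s := rfl

lemma continuous_kernel (A a : Fin p → ℝ) (B b : Fin q → ℝ) : Continuous (kernel A a B b) :=
  (continuous_binetSum A a).sub (continuous_binetSum B b)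

lemma expBounded_kernel (hA : ∀ k, 0 < A k) (hB : ∀ j, 0 < B j) :
    ExpBounded (kernelRate A a B b) (kernel A a B b) :=
  ((expBounded_binetSum hA).mono (le_max_left _ _)).sub
    ((expBounded_binetSum hB).mono (le_max_right _ _))

lemma kernelRate_nonneg (hA : ∀ k, 0 < A k) : 0 ≤ kernelRate A a B b :=
  le_max_of_le_left (growthRate_nonneg hA)

lemma IsBalanced.mul_kernel (h : IsBalanced A a B b) {t : ℝ} (ht : 0 < t) :
    t * kernel A a B b t = Q A a B b (Real.exp (-t)) := by
  have hmu := h.mu_eq_zero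
  rw [mu] at hmu
  rw [kernel, mul_sub, mul_binetSum h.pos_left ht, mul_binetSum h.pos_right ht, Q, h.sum_eq,
    Fintype.card_fin, Fintype.card_fin]
  linarith

lemma rho_eq_exp (hA : ∀ k, 0 < A k) (hB : ∀ j, 0 < B j) :
    rho A B = Real.exp (∑ k, A k * Real.log (A k) - ∑ j, B j * Real.log (B j)) := by
  rw [rho, sub_eq_add_neg, Real.exp_add, ← Finset.sum_neg_distrib, Real.exp_sum, Real.exp_sum]
  congr 1
  · exact Finset.prod_congr rfl fun k _ => by rw [Real.rpow_def_of_pos (hA k), mul_comm]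
  · exact Finset.prod_congr rfl fun j _ => by
      rw [Real.rpow_def_of_pos (hB j), mul_neg, mul_comm]

lemma rho_pos (hA : ∀ k, 0 < A k) (hB : ∀ j, 0 < B j) : 0 < rho A B := by
  rw [rho_eq_exp hA hB]
  exact Real.exp_pos _

lemma nu_eq_exp (hA : ∀ k, 0 < A k) (hB : ∀ j, 0 < B j) :
    nu A a B b = Real.exp (((p : ℝ) - q) / 2 * Real.log (2 * Real.pi)
      + ∑ k, (a k - 1 / 2) * Real.log (A k) - ∑ j, (b j - 1 / 2) * Real.log (B j)) := by
  rw [nu, sub_eq_add_neg (_ + _), ← Finset.sum_neg_distrib, Real.exp_add, Real.exp_add,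
    Real.exp_sum, Real.exp_sum, Real.rpow_def_of_pos (by positivity), mul_comm (Real.log _)]
  congr 2
  · exact Finset.prod_congr rfl fun k _ => by rw [Real.rpow_def_of_pos (hA k), mul_comm]
  · ext j
    rw [Real.rpow_def_of_pos (hB j), ← neg_mul, neg_sub, mul_comm]

lemma IsBalanced.normRatio_ofReal (h : IsBalanced A a B b) {s : ℝ}
    (hs : kernelRate A a B b < s) :
    normRatio A a B b s
      = ((nu A a B b * Real.exp (realLaplace (kernel A a B b) s) : ℝ) : ℂ) := by
  have hs0 : 0 < s := (kernelRate_nonneg h.pos_left).trans_lt hs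
  obtain ⟨hsA, hsB⟩ := max_lt_iff.1 hs
  have hmu := h.mu_eq_zero
  rw [mu] at hmu
  have hkernel : realLaplace (kernel A a B b) s
      = realLaplace (binetSum A a) s - realLaplace (binetSum B b) s :=
    ((expBounded_binetSum h.pos_left).mono (le_max_left _ _)).realLaplace_sub
      ((expBounded_binetSum h.pos_right).mono (le_max_right _ _)) hs
  rw [normRatio, gammaRatio_eq, gammaProd_ofReal h.pos_left hsA, gammaProd_ofReal h.pos_right hsB,
    rho_eq_exp h.pos_left h.pos_right, nu_eq_exp h.pos_left h.pos_right, ← Complex.ofReal_neg,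
    ← Complex.ofReal_cpow (Real.exp_pos _).le, ← Complex.ofReal_div, ← Complex.ofReal_mul,
    ← Real.exp_sub, ← Real.exp_mul, ← Real.exp_add, ← Real.exp_add, hkernel,
    sum_stirlingMain h.pos_left hs0, sum_stirlingMain h.pos_right hs0, h.sum_eq,
    Fintype.card_fin, Fintype.card_fin]
  congr 2
  linear_combination (-(Real.log s)) * hmu

end Balanced

/-! ### The Volterra equation -/

section Volterra

open scoped BoundedContinuousFunction

/-- The convolution `∫ w in 0..t, y w * N (t - w)` divided by `t`, rescaled to the unit interval so
that it makes sense on the whole line and acts on bounded continuous functions. -/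
noncomputable def scaledConvolution (N y : ℝ →ᵇ ℝ) : ℝ →ᵇ ℝ :=
  BoundedContinuousFunction.ofNormedAddCommGroup
    (fun t => ∫ θ in (0 : ℝ)..1, y (t * θ) * N (t * (1 - θ)))
    (intervalIntegral.continuous_parametric_intervalIntegral_of_continuous' (by fun_prop) 0 1)
    (‖y‖ * ‖N‖) fun t => by
      simpa using intervalIntegral.norm_integral_le_of_norm_le_const (a := (0 : ℝ)) (b := 1)
        fun θ _ => norm_mul_le_of_le (y.norm_coe_le_norm (t * θ))
          (N.norm_coe_le_norm (t * (1 - θ)))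

variable (N y z : ℝ →ᵇ ℝ)

lemma scaledConvolution_apply (t : ℝ) :
    scaledConvolution N y t = ∫ θ in (0 : ℝ)..1, y (t * θ) * N (t * (1 - θ)) :=
  rfl

lemma norm_scaledConvolution_le : ‖scaledConvolution N y‖ ≤ ‖N‖ * ‖y‖ := by
  rw [mul_comm]
  exact BoundedContinuousFunction.norm_ofNormedAddCommGroup_le _ (by positivity) _

lemma scaledConvolution_sub :
    scaledConvolution N (y - z) = scaledConvolution N y - scaledConvolution N z := by
  ext t
  have hinteg (w : ℝ →ᵇ ℝ) :
      IntervalIntegrable (fun θ => w (t * θ) * N (t * (1 - θ))) volume 0 1 :=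
    Continuous.intervalIntegrable (by fun_prop) _ _
  simp only [scaledConvolution_apply, BoundedContinuousFunction.coe_sub, Pi.sub_apply, sub_mul]
  exact intervalIntegral.integral_sub (hinteg y) (hinteg z)

lemma mul_scaledConvolution (t : ℝ) :
    t * scaledConvolution N y t = ∫ w in (0 : ℝ)..t, y w * N (t - w) := by
  simpa [scaledConvolution_apply, mul_sub] using
    intervalIntegral.smul_integral_comp_mul_left (a := 0) (b := 1) (fun w => y w * N (t - w)) t

variable {N} in
lemma exists_eq_add_scaledConvolution (hN : ‖N‖ < 1) (f : ℝ →ᵇ ℝ) :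
    ∃ y, y = f + scaledConvolution N y := by
  have hcontr : ContractingWith ‖N‖₊ fun y => f + scaledConvolution N y := by
    refine ⟨hN, LipschitzWith.of_dist_le_mul fun y z => ?_⟩
    rw [dist_add_left, dist_eq_norm, dist_eq_norm, ← scaledConvolution_sub]
    exact norm_scaledConvolution_le N (y - z)
  exact ⟨_, hcontr.fixedPoint_isFixedPt.symm⟩

/-- The Volterra equation obtained from `ν + L h = ν exp (L k)`, where `L` is the Laplace
transform, by taking the logarithmic derivative. -/
def IsVolterraSolution (k : ℝ → ℝ) (ν : ℝ) (h : ℝ → ℝ) : Prop :=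
  ∀ t, 0 < t → t * h t = ν * (t * k t) + ∫ w in (0 : ℝ)..t, h w * ((t - w) * k (t - w))

variable {k h : ℝ → ℝ} {m σ ν : ℝ}

lemma ExpBounded.exists_abs_le (hk : Continuous k) (hkm : ExpBounded m k) :
    ∃ C, 0 ≤ C ∧ ∀ t, 0 ≤ t → |k t| ≤ C * Real.exp (m * t) := by
  obtain ⟨C, hC0, hC⟩ := hkm.bound
  have hclosed : IsClosed {t | |k t| ≤ C * Real.exp (m * t)} :=
    isClosed_le (by fun_prop) (by fun_prop)
  refine ⟨C, hC0, fun t ht => closure_minimal (s := Ioi 0) (fun t => hC t) hclosed ?_⟩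
  rwa [closure_Ioi]

lemma isVolterraSolution_of_eq_add_scaledConvolution {f N y : ℝ →ᵇ ℝ}
    (hy : y = f + scaledConvolution N y)
    (hf : ∀ t, 0 ≤ t → f t = ν * (Real.exp (-(σ * t)) * k t))
    (hN : ∀ t, 0 ≤ t → N t = Real.exp (-(σ * t)) * (t * k t)) :
    IsVolterraSolution k ν fun t => Real.exp (σ * t) * y t := by
  intro t ht
  have hconv : Real.exp (σ * t) * ∫ w in (0 : ℝ)..t, y w * N (t - w)
      = ∫ w in (0 : ℝ)..t, (Real.exp (σ * w) * y w) * ((t - w) * k (t - w)) := by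
    rw [← intervalIntegral.integral_const_mul]
    refine intervalIntegral.integral_congr fun w hw => ?_
    rw [uIcc_of_le ht.le] at hw
    have hexp : Real.exp (σ * t) * Real.exp (-(σ * (t - w))) = Real.exp (σ * w) := by
      rw [← Real.exp_add]
      ring_nf
    simp only [hN (t - w) (sub_nonneg.2 hw.2), ← hexp]
    ring
  have hyt : y t = f t + scaledConvolution N y t := DFunLike.congr_fun hy t
  have hexp : Real.exp (σ * t) * Real.exp (-(σ * t)) = 1 := by
    rw [← Real.exp_add, add_neg_cancel, Real.exp_zero]
  beta_reduce
  rw [← hconv, ← mul_scaledConvolution, hyt, hf t ht.le]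
  linear_combination (ν * (t * k t)) * hexp

lemma abs_exp_neg_mul_mul_le {C : ℝ} (hC : ∀ t, 0 ≤ t → |k t| ≤ C * Real.exp (m * t))
    (D v : ℝ) :
    |Real.exp (-((m + D) * |v|)) * k (|v|)| ≤ C * Real.exp (-(D * |v|)) :=
  calc |Real.exp (-((m + D) * |v|)) * k (|v|)|
      ≤ Real.exp (-((m + D) * |v|)) * (C * Real.exp (m * |v|)) := by
        rw [abs_mul, Real.abs_exp]
        gcongr
        exact hC _ (abs_nonneg v)
    _ = C * Real.exp (-(D * |v|)) := by
        rw [mul_left_comm, ← Real.exp_add]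
        ring_nf

lemma exists_isVolterraSolution (hk : Continuous k) (hkm : ExpBounded m k) (ν : ℝ) :
    ∃ σ, m < σ ∧ ∃ h, Continuous h ∧ ExpBounded σ h ∧ IsVolterraSolution k ν h := by
  obtain ⟨C, hC0, hC⟩ := hkm.exists_abs_le hk
  set σ := m + (2 * C + 1)
  have hdamped := abs_exp_neg_mul_mul_le hC (2 * C + 1)
  have hN (v : ℝ) : ‖Real.exp (-(σ * |v|)) * (|v| * k |v|)‖ ≤ 1 / 2 :=
    calc ‖Real.exp (-(σ * |v|)) * (|v| * k |v|)‖
        = |v| * |Real.exp (-(σ * |v|)) * k (|v|)| := by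
          rw [mul_left_comm, Real.norm_eq_abs, abs_mul, abs_abs]
      _ ≤ |v| * (C * Real.exp (-((2 * C + 1) * |v|))) := by gcongr; exact hdamped v
      _ ≤ 1 / 2 := by
          have hexp := Real.add_one_le_exp ((2 * C + 1) * |v|)
          rw [Real.exp_neg, ← mul_assoc, ← div_eq_mul_inv, div_le_iff₀ (Real.exp_pos _)]
          linarith [abs_nonneg v]
  let N : ℝ →ᵇ ℝ := BoundedContinuousFunction.ofNormedAddCommGroup _ (by fun_prop) _ hN
  let f : ℝ →ᵇ ℝ := ν • BoundedContinuousFunction.ofNormedAddCommGroup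
    (fun v => Real.exp (-(σ * |v|)) * k |v|) (by fun_prop) C fun v =>
      (hdamped v).trans (mul_le_of_le_one_right hC0 (Real.exp_le_one_iff.2 (by
        rw [neg_nonpos]
        positivity)))
  obtain ⟨y, hy⟩ := exists_eq_add_scaledConvolution (N := N)
    ((BoundedContinuousFunction.norm_ofNormedAddCommGroup_le _ (by norm_num) hN).trans_lt
      (by norm_num)) f
  refine ⟨σ, by linarith, fun t => Real.exp (σ * t) * y t, by fun_prop,
    ⟨by fun_prop, ‖y‖, norm_nonneg y, fun t _ => ?_⟩,
    isVolterraSolution_of_eq_add_scaledConvolution hy (fun t ht => ?_) fun t ht => ?_⟩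
  · rw [abs_mul, Real.abs_exp, mul_comm]
    gcongr
    exact y.norm_coe_le_norm t
  · simp [f, abs_of_nonneg ht]
  · simp [N, abs_of_nonneg ht]

lemma IsVolterraSolution.realLaplace_id_mul (heq : IsVolterraSolution k ν h)
    (hkm : ExpBounded m k) (hσ : m < σ) (hh : ExpBounded σ h) {x : ℝ} (hx : σ < x) :
    realLaplace (fun t => t * h t) x
      = (ν + realLaplace h x) * realLaplace (fun t => t * k t) x := by
  have htk : ExpBounded σ fun t => t * k t := hkm.id_mul hσ
  obtain ⟨σ', hσσ', hσ'x⟩ := exists_between hx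
  have hsub := (hh.id_mul hσσ').realLaplace_sub ((htk.mono hσσ'.le).const_mul ν) hσ'x
  have hconv := hh.realLaplace_convolution htk hx
  rw [realLaplace_const_mul] at hsub
  rw [realLaplace_congr (g := fun t => t * h t - ν * (t * k t))
    fun t ht => (sub_eq_of_eq_add' (heq t ht)).symm, hsub] at hconv
  linear_combination hconv

lemma IsVolterraSolution.add_realLaplace (heq : IsVolterraSolution k ν h)
    (hkm : ExpBounded m k) (hσ : m < σ) (hh : ExpBounded σ h) {x : ℝ} (hx : σ < x) :
    ν + realLaplace h x = ν * Real.exp (realLaplace k x) := by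
  have hderiv (y : ℝ) (hy : σ < y) :
      HasDerivAt (fun y => (ν + realLaplace h y) * Real.exp (-realLaplace k y)) 0 y := by
    refine (((hh.hasDerivAt_realLaplace hy).const_add ν).fun_mul
      (hkm.hasDerivAt_realLaplace (hσ.trans hy)).fun_neg.exp).congr_deriv ?_
    rw [heq.realLaplace_id_mul hkm hσ hh hy]
    ring
  have hlim : Tendsto (fun y => (ν + realLaplace h y) * Real.exp (-realLaplace k y)) atTop
      (𝓝 ν) := by
    simpa using (hh.tendsto_realLaplace.const_add ν).mul
      ((Real.continuous_exp.tendsto _).comp hkm.tendsto_realLaplace.neg)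
  have hconst := eq_of_hasDerivAt_of_tendsto hderiv (fun y _ => hasDerivAt_const y ν) hlim
    tendsto_const_nhds hx
  rwa [Real.exp_neg, ← div_eq_mul_inv, div_eq_iff (Real.exp_pos _).ne'] at hconst

end Volterra

/-! ### Analyticity of the gamma ratio -/

section Analyticity

variable {ι : Type*} [Fintype ι] {A a : ι → ℝ} {s : ℂ}

lemma differentiableAt_gammaProd (h : ∀ k, ∀ n : ℕ, (A k : ℂ) * s + a k ≠ -n) :
    DifferentiableAt ℂ (gammaProd A a) s :=
  DifferentiableAt.fun_finsetProd fun k _ => (Complex.differentiableAt_Gamma _ (h k)).comp s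
    (f := fun s : ℂ => (A k : ℂ) * s + (a k : ℂ)) (by fun_prop)

lemma differentiableAt_gammaProd_of_im_ne_zero (hA : ∀ k, 0 < A k) (hs : s.im ≠ 0) :
    DifferentiableAt ℂ (gammaProd A a) s := by
  refine differentiableAt_gammaProd fun k n h => ?_
  have him : A k * s.im = 0 := by simpa using congrArg Complex.im h
  exact mul_ne_zero (hA k).ne' hs him

lemma differentiableAt_gammaProd_of_lt_re (hA : ∀ k, 0 < A k) (hs : ∀ k, -(a k / A k) < s.re) :
    DifferentiableAt ℂ (gammaProd A a) s := by
  refine differentiableAt_gammaProd fun k n h => ?_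
  have hre : A k * s.re + a k = -n := by simpa using congrArg Complex.re h
  have hk := hs k
  rw [← neg_div, div_lt_iff₀' (hA k)] at hk
  linarith [n.cast_nonneg (α := ℝ)]

lemma differentiable_inv_gammaProd (A a : ι → ℝ) :
    Differentiable ℂ fun s => (gammaProd A a s)⁻¹ := by
  simp only [gammaProd, ← Finset.prod_inv_distrib]
  exact Differentiable.fun_finsetProd fun k _ => Complex.differentiable_one_div_Gamma.comp
    (f := fun s : ℂ => (A k : ℂ) * s + (a k : ℂ)) (by fun_prop)

variable {p q : ℕ} {A a : Fin p → ℝ} {B b : Fin q → ℝ}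

lemma differentiableAt_gammaRatio (h : DifferentiableAt ℂ (gammaProd A a) s) :
    DifferentiableAt ℂ (gammaRatio A a B b) s :=
  (h.mul (differentiable_inv_gammaProd B b s)).congr_of_eventuallyEq
    (Eventually.of_forall fun s => div_eq_mul_inv (gammaProd A a s) (gammaProd B b s))

lemma normRatio_eq_mul_exp (hA : ∀ k, 0 < A k) (hB : ∀ j, 0 < B j) (s : ℂ) :
    normRatio A a B b s = gammaRatio A a B b s * Complex.exp (-s * Real.log (rho A B)) := by
  rw [normRatio, Complex.cpow_def_of_ne_zero (by exact_mod_cast (rho_pos hA hB).ne'),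
    ← Complex.ofReal_log (rho_pos hA hB).le, mul_comm (-s)]

lemma differentiableAt_normRatio (hA : ∀ k, 0 < A k) (hB : ∀ j, 0 < B j)
    (h : DifferentiableAt ℂ (gammaProd A a) s) : DifferentiableAt ℂ (normRatio A a B b) s := by
  rw [funext (normRatio_eq_mul_exp hA hB)]
  have := differentiableAt_gammaRatio (B := B) (b := b) h
  fun_prop

end Analyticity

lemma eqOn_re_gt_of_eq_ofReal {f g : ℂ → ℂ} {σ : ℝ}
    (hf : ∀ s : ℂ, σ < s.re → DifferentiableAt ℂ f s)
    (hg : ∀ s : ℂ, σ < s.re → DifferentiableAt ℂ g s) (hfg : ∀ x : ℝ, σ < x → f x = g x) :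
    EqOn f g {s | σ < s.re} := by
  have hopen : IsOpen {s : ℂ | σ < s.re} := isOpen_lt continuous_const Complex.continuous_re
  have hreal : Tendsto Complex.ofReal (𝓝[≠] (σ + 1)) (𝓝[≠] ((σ + 1 : ℝ) : ℂ)) :=
    Complex.continuous_ofReal.continuousWithinAt.tendsto_nhdsWithin
      fun _ hx => Complex.ofReal_injective.ne hx
  have hnear : ∀ᶠ x : ℝ in 𝓝[≠] (σ + 1), f x = g x :=
    (eventually_nhdsWithin_of_eventually_nhds (lt_mem_nhds (lt_add_one σ))).mono hfg
  exact (DifferentiableOn.analyticOnNhd (fun s hs => (hf s hs).differentiableWithinAt)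
    hopen).eqOn_of_preconnected_of_frequently_eq
      (DifferentiableOn.analyticOnNhd (fun s hs => (hg s hs).differentiableWithinAt) hopen)
      (convex_halfSpace_re_gt σ).isPreconnected (show σ < _ by simp)
      (hreal.frequently hnear.frequently)

theorem IsBalanced.exists_normRatio_eq {p q : ℕ} {A a : Fin p → ℝ} {B b : Fin q → ℝ}
    (hbal : IsBalanced A a B b) :
    ∃ σ, 0 < σ ∧ ∃ h, Continuous h ∧ ExpBounded σ h ∧
      IsVolterraSolution (kernel A a B b) (nu A a B b) h ∧
      ∀ s : ℂ, σ < s.re → normRatio A a B b s = nu A a B b + laplace h s := by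
  have hA := hbal.pos_left
  have hB := hbal.pos_right
  obtain ⟨σ, hσ, h, hcont, hh, hsol⟩ := exists_isVolterraSolution (continuous_kernel A a B b)
    (expBounded_kernel hA hB) (nu A a B b)
  refine ⟨σ, (kernelRate_nonneg hA).trans_lt hσ, h, hcont, hh, hsol,
    eqOn_re_gt_of_eq_ofReal (fun s hs => ?_) (fun s hs => ?_) fun x hx => ?_⟩
  · refine differentiableAt_normRatio hA hB (differentiableAt_gammaProd_of_lt_re hA fun k => ?_)
    calc -(a k / A k) ≤ |a k / A k| := neg_le_abs _
      _ = |a k| / A k := by rw [abs_div, abs_of_pos (hA k)]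
      _ ≤ kernelRate A a B b := (abs_div_le_growthRate hA k).trans (le_max_left _ _)
      _ < s.re := hσ.trans hs
  · exact ((hh.hasDerivAt_laplace hs).const_add _).differentiableAt
  · rw [hbal.normRatio_ofReal (hσ.trans hx), laplace_ofReal, ← Complex.ofReal_add,
      hsol.add_realLaplace (expBounded_kernel hA hB) hσ hh hx]

/-! ### Bounds away from the real axis -/

lemma norm_Gamma_le_Gamma_re {z : ℂ} (hz : 0 < z.re) :
    ‖Complex.Gamma z‖ ≤ Real.Gamma z.re := by
  rw [Complex.Gamma_eq_integral hz, Real.Gamma_eq_integral hz, Complex.GammaIntegral]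
  refine (norm_integral_le_integral_norm _).trans_eq
    (setIntegral_congr_fun measurableSet_Ioi fun t ht => ?_)
  simp only [norm_mul, Complex.norm_real, Real.norm_eq_abs, Real.abs_exp]
  rw [Complex.norm_cpow_eq_rpow_re_of_pos ht, Complex.sub_re, Complex.one_re]

lemma exists_norm_Gamma_le_of_one_le_re (M : ℝ) :
    ∃ C, 0 ≤ C ∧ ∀ z : ℂ, 1 ≤ z.re → z.re ≤ M → ‖Complex.Gamma z‖ ≤ C := by
  obtain ⟨C, hC⟩ := isCompact_Icc.exists_bound_of_continuousOn (s := Icc (1 : ℝ) M)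
    (f := Real.Gamma) fun x hx => (Real.differentiableAt_Gamma fun m h => by
      linarith [hx.1, m.cast_nonneg (α := ℝ)]).continuousAt.continuousWithinAt
  refine ⟨max C 0, le_max_right _ _, fun z h1 hM => le_max_of_le_left ?_⟩
  exact (norm_Gamma_le_Gamma_re (zero_lt_one.trans_le h1)).trans
    ((le_abs_self _).trans (hC z.re ⟨h1, hM⟩))

lemma exists_norm_Gamma_le_of_le_re {M δ : ℝ} (hM : 2 ≤ M) (hδ : 0 < δ) (n : ℕ) :
    ∃ C, 0 ≤ C ∧ ∀ z : ℂ, 1 - n ≤ z.re → z.re ≤ M → δ ≤ |z.im| → ‖Complex.Gamma z‖ ≤ C := by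
  induction n with
  | zero =>
    obtain ⟨C, hC0, hC⟩ := exists_norm_Gamma_le_of_one_le_re M
    exact ⟨C, hC0, fun z h1 h2 _ => hC z (by simpa using h1) h2⟩
  | succ n ih =>
    obtain ⟨C, hC0, hC⟩ := ih
    refine ⟨max C (C / δ), le_max_of_le_left hC0, fun z hlow hup him => ?_⟩
    push_cast at hlow
    rcases le_total (1 - (n : ℝ)) z.re with h | h
    · exact (hC z h hup him).trans (le_max_left _ _)
    · have hz : z ≠ 0 := fun hz => hδ.not_ge (by simpa [hz] using him)
      have hshift := hC (z + 1) (by simp; linarith) (by simp; linarith [n.cast_nonneg (α := ℝ)])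
        (by simpa using him)
      rw [Complex.Gamma_add_one z hz, norm_mul] at hshift
      refine le_max_of_le_right ((le_div_iff₀' hδ).2 (hshift.trans' ?_))
      gcongr
      exact him.trans (Complex.abs_im_le_norm z)

lemma exists_norm_Gamma_le_of_abs_re_le (M : ℝ) {δ : ℝ} (hδ : 0 < δ) :
    ∃ C, 0 ≤ C ∧ ∀ z : ℂ, |z.re| ≤ M → δ ≤ |z.im| → ‖Complex.Gamma z‖ ≤ C := by
  obtain ⟨n, hn⟩ := exists_nat_ge (M + 1)
  obtain ⟨C, hC0, hC⟩ := exists_norm_Gamma_le_of_le_re (le_max_right M 2) hδ n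
  exact ⟨C, hC0, fun z hre => hC z (by linarith [neg_abs_le z.re])
    ((le_abs_self _).trans (hre.trans (le_max_left _ _)))⟩

lemma norm_sin_le (w : ℂ) : ‖Complex.sin w‖ ≤ Real.exp |w.im| := by
  have hneg : ‖Complex.exp (-w * Complex.I)‖ ≤ Real.exp |w.im| := by
    simpa [Complex.norm_exp] using le_abs_self w.im
  have hpos : ‖Complex.exp (w * Complex.I)‖ ≤ Real.exp |w.im| := by
    simpa [Complex.norm_exp] using neg_le_abs w.im
  rw [Complex.sin, norm_div, norm_mul, Complex.norm_I, mul_one, Complex.norm_ofNat]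
  linarith [norm_sub_le (Complex.exp (-w * Complex.I)) (Complex.exp (w * Complex.I))]

lemma le_norm_sin {δ : ℝ} {w : ℂ} (hw : δ ≤ |w.im|) :
    (1 - Real.exp (-(2 * δ))) / 2 * Real.exp |w.im| ≤ ‖Complex.sin w‖ := by
  have hdiff := abs_norm_sub_norm_le (Complex.exp (-w * Complex.I)) (Complex.exp (w * Complex.I))
  have habs : Real.exp |w.im| - Real.exp (-|w.im|) ≤ |Real.exp w.im - Real.exp (-w.im)| := by
    rcases abs_choice w.im with h | h
    · rw [h]
      exact le_abs_self _
    · rw [h, neg_neg, abs_sub_comm]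
      exact le_abs_self _
  have hexp : Real.exp (-|w.im|) ≤ Real.exp (-(2 * δ)) * Real.exp |w.im| := by
    rw [← Real.exp_add]
    exact Real.exp_le_exp.2 (by linarith)
  simp only [Complex.norm_exp, neg_mul, Complex.neg_re, Complex.mul_I_re, neg_neg] at hdiff
  rw [Complex.sin, norm_div, norm_mul, Complex.norm_I, mul_one, Complex.norm_ofNat, neg_mul]
  linarith

lemma abs_im_pi_mul_add {x : ℝ} (hx : 0 < x) (d : ℝ) (s : ℂ) :
    |((Real.pi : ℂ) * ((x : ℂ) * s + (d : ℂ))).im| = Real.pi * x * |s.im| := by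
  rw [Complex.im_ofReal_mul, Complex.add_im, Complex.im_ofReal_mul, Complex.ofReal_im, add_zero,
    abs_mul, abs_mul, abs_of_pos Real.pi_pos, abs_of_pos hx, mul_assoc]

section GammaFamily

variable {ι : Type*} [Fintype ι] {A a : ι → ℝ} {s : ℂ} {φ : ℝ}

lemma exists_norm_gammaProd_le (hA : ∀ k, 0 < A k) (a : ι → ℝ) (M : ℝ) (hφ : 0 < φ) :
    ∃ C, 0 ≤ C ∧ ∀ s : ℂ, |s.re| ≤ M → φ ≤ |s.im| → ‖gammaProd A a s‖ ≤ C := by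
  choose C hC0 hC using fun k =>
    exists_norm_Gamma_le_of_abs_re_le (A k * M + |a k|) (mul_pos (hA k) hφ)
  refine ⟨∏ k, C k, Finset.prod_nonneg fun k _ => hC0 k, fun s hre him => ?_⟩
  rw [gammaProd, norm_prod]
  refine Finset.prod_le_prod (fun k _ => norm_nonneg _) fun k _ => ?_
  have hAk := hA k
  refine hC k _ ?_ ?_
  · simp only [Complex.add_re, Complex.re_ofReal_mul, Complex.ofReal_re]
    refine (abs_add_le _ _).trans ?_
    rw [abs_mul, abs_of_pos hAk]
    gcongr
  · simp only [Complex.add_im, Complex.im_ofReal_mul, Complex.ofReal_im, add_zero]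
    rw [abs_mul, abs_of_pos hAk]
    gcongr

/-- The product of sines that relates `gammaProd A a s` to `gammaProd A (1 - a) (-s)` by Euler's
reflection formula. -/
noncomputable def sinProd (A a : ι → ℝ) (s : ℂ) : ℂ :=
  ∏ k, Complex.sin (Real.pi * ((A k : ℂ) * s + (a k : ℂ)))

lemma gammaProd_mul_gammaProd_reflect (A a : ι → ℝ) (s : ℂ) :
    gammaProd A a s * gammaProd A (1 - a) (-s) = Real.pi ^ Fintype.card ι / sinProd A a s := by
  rw [gammaProd, gammaProd, ← Finset.prod_mul_distrib, sinProd, ← Finset.card_univ,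
    ← Finset.prod_const, ← Finset.prod_div_distrib]
  refine Finset.prod_congr rfl fun k _ => ?_
  rw [← Complex.Gamma_mul_Gamma_one_sub]
  simp only [Pi.sub_apply, Pi.one_apply]
  push_cast
  ring_nf

lemma exp_pi_mul_sum_mul (A : ι → ℝ) (y : ℝ) :
    Real.exp (Real.pi * (∑ k, A k) * y) = ∏ k, Real.exp (Real.pi * A k * y) := by
  rw [← Real.exp_sum, Finset.mul_sum, Finset.sum_mul]

lemma norm_sinProd_le (hA : ∀ k, 0 < A k) :
    ‖sinProd A a s‖ ≤ Real.exp (Real.pi * (∑ k, A k) * |s.im|) := by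
  rw [sinProd, norm_prod, exp_pi_mul_sum_mul]
  exact Finset.prod_le_prod (fun _ _ => norm_nonneg _) fun k _ =>
    (norm_sin_le _).trans_eq (by rw [abs_im_pi_mul_add (hA k)])

lemma exists_le_norm_sinProd (hA : ∀ k, 0 < A k) (a : ι → ℝ) (hφ : 0 < φ) :
    ∃ c, 0 < c ∧ ∀ s : ℂ, φ ≤ |s.im| →
      c * Real.exp (Real.pi * (∑ k, A k) * |s.im|) ≤ ‖sinProd A a s‖ := by
  let c (k : ι) : ℝ := (1 - Real.exp (-(2 * (Real.pi * A k * φ)))) / 2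
  have hc (k : ι) : 0 < c k := by
    have hAk := hA k
    refine half_pos (sub_pos.2 (Real.exp_lt_one_iff.2 (neg_neg_of_pos ?_)))
    positivity
  refine ⟨∏ k, c k, Finset.prod_pos fun k _ => hc k, fun s hs => ?_⟩
  rw [sinProd, norm_prod, exp_pi_mul_sum_mul, ← Finset.prod_mul_distrib]
  refine Finset.prod_le_prod (fun k _ => (mul_pos (hc k) (Real.exp_pos _)).le) fun k _ => ?_
  have hAk := hA k
  rw [← abs_im_pi_mul_add (hA k) (a k)]
  exact le_norm_sin (by rw [abs_im_pi_mul_add hAk]; gcongr)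

lemma sinProd_ne_zero (hA : ∀ k, 0 < A k) (hs : s.im ≠ 0) : sinProd A a s ≠ 0 := by
  obtain ⟨c, hc, hle⟩ := exists_le_norm_sinProd hA a (abs_pos.2 hs)
  exact norm_pos_iff.1 ((mul_pos hc (Real.exp_pos _)).trans_le (hle s le_rfl))

lemma inv_gammaProd_eq (hA : ∀ k, 0 < A k) (hs : s.im ≠ 0) :
    (gammaProd A a s)⁻¹
      = gammaProd A (1 - a) (-s) * (sinProd A a s / Real.pi ^ Fintype.card ι) := by
  refine inv_eq_of_mul_eq_one_right ?_
  rw [← mul_assoc, gammaProd_mul_gammaProd_reflect]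
  have hsin := sinProd_ne_zero (a := a) hA hs
  have hpi : (Real.pi : ℂ) ≠ 0 := by exact_mod_cast Real.pi_ne_zero
  field_simp

lemma exists_norm_inv_gammaProd_le (hA : ∀ k, 0 < A k) (a : ι → ℝ) (M : ℝ) (hφ : 0 < φ) :
    ∃ C, 0 ≤ C ∧ ∀ s : ℂ, |s.re| ≤ M → φ ≤ |s.im| →
      ‖(gammaProd A a s)⁻¹‖ ≤ C * Real.exp (Real.pi * (∑ k, A k) * |s.im|) := by
  obtain ⟨C, hC0, hC⟩ := exists_norm_gammaProd_le hA (1 - a) M hφ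
  refine ⟨C / Real.pi ^ Fintype.card ι, by positivity, fun s hre him => ?_⟩
  rw [inv_gammaProd_eq hA (abs_pos.1 (hφ.trans_le him)), norm_mul, norm_div, norm_pow,
    Complex.norm_real, Real.norm_of_nonneg Real.pi_pos.le, div_mul_eq_mul_div, ← mul_div_assoc]
  gcongr
  · exact hC (-s) (by simpa using hre) (by simpa using him)
  · exact norm_sinProd_le hA

end GammaFamily

lemma exists_norm_le_of_norm_le_exp {f : ℂ → ℂ} {M φ C K D : ℝ} (hD : 0 ≤ D)
    (hd : ∀ s : ℂ, φ ≤ s.im → DifferentiableAt ℂ f s)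
    (hleft : ∀ s : ℂ, s.re ≤ -M → φ ≤ s.im → ‖f s‖ ≤ C)
    (hgrowth : ∀ s : ℂ, φ ≤ s.im → ‖f s‖ ≤ K * Real.exp (D * s.im)) :
    ∃ C', ∀ s : ℂ, φ ≤ s.im → ‖f s‖ ≤ C' := by
  set corner : ℂ := ⟨-M, φ⟩
  have hcl : closure (Ioi 0 ×ℂ Ioi 0) = Ici (0 : ℝ) ×ℂ Ici (0 : ℝ) := by
    rw [Complex.closure_reProdIm, closure_Ioi]
  have hdiff : DiffContOnCl ℂ (fun z => f (z + corner)) (Ioi 0 ×ℂ Ioi 0) := by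
    refine DifferentiableOn.diffContOnCl fun z hz => ?_
    rw [hcl] at hz
    have hfz : DifferentiableAt ℂ f (z + corner) := hd _ (by simpa [corner] using hz.2)
    exact (hfz.comp z (f := fun z => z + corner) (by fun_prop)).differentiableWithinAt
  have hK : 0 ≤ K := nonneg_of_mul_nonneg_left
    ((norm_nonneg _).trans (hgrowth corner le_rfl)) (Real.exp_pos _)
  have horder : (fun z => f (z + corner)) =O[Bornology.cobounded ℂ ⊓ 𝓟 (Ioi 0 ×ℂ Ioi 0)]
      fun z => Real.exp (D * ‖z‖ ^ (1 : ℝ)) := by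
    refine Asymptotics.IsBigO.of_bound (K * Real.exp (D * φ)) (eventually_inf_principal.2
      (Eventually.of_forall fun z hz => ?_))
    have him : (z + corner).im ≤ ‖z‖ + φ := by
      simpa [corner] using (le_abs_self _).trans (Complex.abs_im_le_norm z)
    calc ‖f (z + corner)‖ ≤ K * Real.exp (D * (z + corner).im) :=
          hgrowth _ (by simpa [corner] using (mem_Ioi.1 hz.2).le)
      _ ≤ K * Real.exp (D * (‖z‖ + φ)) := by gcongr
      _ = K * Real.exp (D * φ) * ‖Real.exp (D * ‖z‖ ^ (1 : ℝ))‖ := by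
          rw [Real.rpow_one, Real.norm_eq_abs, Real.abs_exp, mul_assoc, ← Real.exp_add]
          ring_nf
  refine ⟨max C (K * Real.exp (D * φ)), fun s hs => ?_⟩
  rcases le_total s.re (-M) with hsM | hsM
  · exact (hleft s hsM hs).trans (le_max_left _ _)
  · rw [← sub_add_cancel s corner]
    refine PhragmenLindelof.quadrant_I (f := fun z => f (z + corner)) hdiff
      ⟨1, one_lt_two, D, horder⟩ (fun x _ => ?_) (fun y hy => ?_)
      (by simpa [corner] using neg_le_iff_add_nonneg.1 hsM) (by simpa [corner] using hs)
    · exact (hgrowth _ (by simp [corner])).trans_eq (by simp [corner]) |>.trans (le_max_right _ _)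
    · exact (hleft _ (by simp [corner]) (by simpa [corner] using hy)).trans (le_max_left _ _)

section Ratio

variable {p q : ℕ} {A a : Fin p → ℝ} {B b : Fin q → ℝ} {φ : ℝ}

lemma exists_norm_normRatio_le_exp_of_abs_re_le (hA : ∀ k, 0 < A k) (hB : ∀ j, 0 < B j)
    (a : Fin p → ℝ) (b : Fin q → ℝ) (M : ℝ) (hφ : 0 < φ) :
    ∃ C, ∀ s : ℂ, |s.re| ≤ M → φ ≤ |s.im| →
      ‖normRatio A a B b s‖ ≤ C * Real.exp (Real.pi * (∑ j, B j) * |s.im|) := by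
  obtain ⟨C, hC0, hC⟩ := exists_norm_gammaProd_le hA a M hφ
  obtain ⟨C', hC'0, hC'⟩ := exists_norm_inv_gammaProd_le hB b M hφ
  refine ⟨C * C' * Real.exp (M * |Real.log (rho A B)|), fun s hre him => ?_⟩
  have hpow : ‖Complex.exp (-s * Real.log (rho A B))‖ ≤ Real.exp (M * |Real.log (rho A B)|) := by
    rw [Complex.norm_exp, Complex.re_mul_ofReal, Complex.neg_re]
    refine Real.exp_le_exp.2 ((le_abs_self _).trans ?_)
    rw [abs_mul, abs_neg]
    gcongr
  rw [normRatio_eq_mul_exp hA hB, gammaRatio_eq, div_eq_mul_inv, norm_mul, norm_mul]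
  calc _ ≤ C * (C' * Real.exp (Real.pi * (∑ j, B j) * |s.im|))
        * Real.exp (M * |Real.log (rho A B)|) := by
        gcongr
        · exact hC s hre him
        · exact hC' s hre him
    _ = _ := by ring

lemma log_rho_swap (hA : ∀ k, 0 < A k) (hB : ∀ j, 0 < B j) :
    Real.log (rho B A) = -Real.log (rho A B) := by
  rw [rho_eq_exp hA hB, rho_eq_exp hB hA, Real.log_exp, Real.log_exp, neg_sub]

lemma IsBalanced.reflect (h : IsBalanced A a B b) : IsBalanced B (1 - b) A (1 - a) where
  pos_left := h.pos_right
  pos_right := h.pos_left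
  mu_eq_zero := by
    rw [← h.mu_eq_zero]
    simp only [mu, Pi.sub_apply, Pi.one_apply, Finset.sum_sub_distrib, Finset.sum_const,
      Finset.card_univ, Fintype.card_fin, nsmul_eq_mul, mul_one]
    ring
  sum_eq := h.sum_eq.symm

lemma normRatio_reflect (hA : ∀ k, 0 < A k) (hB : ∀ j, 0 < B j) {s : ℂ} (hs : s.im ≠ 0) :
    normRatio A a B b s = normRatio B (1 - b) A (1 - a) (-s) *
      (Real.pi ^ p / Real.pi ^ q * (sinProd B b s / sinProd A a s)) := by
  have hpow : Complex.exp (-(-s) * Real.log (rho B A)) = Complex.exp (-s * Real.log (rho A B)) := by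
    rw [log_rho_swap hA hB, Complex.ofReal_neg, neg_mul_comm, neg_neg]
  rw [normRatio_eq_mul_exp hA hB, normRatio_eq_mul_exp hB hA, hpow, gammaRatio_eq, gammaRatio_eq,
    ← inv_inv (gammaProd A a s), inv_gammaProd_eq hA hs, div_eq_mul_inv _ (gammaProd B b s),
    inv_gammaProd_eq hB hs, Fintype.card_fin, Fintype.card_fin]
  simp only [div_eq_mul_inv, mul_inv, inv_inv]
  ring

namespace IsBalanced

lemma exists_norm_normRatio_le_of_le_re (h : IsBalanced A a B b) :
    ∃ M C, ∀ s : ℂ, M ≤ s.re → ‖normRatio A a B b s‖ ≤ C := by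
  obtain ⟨σ, -, f, -, hf, -, heq⟩ := h.exists_normRatio_eq
  obtain ⟨C, hC0, hC⟩ := hf.exists_norm_laplace_le
  refine ⟨σ + 1, ‖(nu A a B b : ℂ)‖ + C, fun s hs => ?_⟩
  rw [heq s (by linarith)]
  refine norm_add_le_of_le le_rfl ((hC s (by linarith)).trans ?_)
  exact div_le_self hC0 (by linarith)

lemma exists_norm_normRatio_le_of_re_le (h : IsBalanced A a B b) (hφ : 0 < φ) :
    ∃ M C, ∀ s : ℂ, s.re ≤ -M → φ ≤ |s.im| → ‖normRatio A a B b s‖ ≤ C := by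
  obtain ⟨M, C, hC⟩ := h.reflect.exists_norm_normRatio_le_of_le_re
  obtain ⟨c, hc, hsin⟩ := exists_le_norm_sinProd h.pos_left a hφ
  refine ⟨M, C * (Real.pi ^ p / Real.pi ^ q * c⁻¹), fun s hre him => ?_⟩
  have hquot : ‖sinProd B b s / sinProd A a s‖ ≤ c⁻¹ :=
    calc ‖sinProd B b s / sinProd A a s‖
        ≤ Real.exp (Real.pi * (∑ k, A k) * |s.im|)
            / (c * Real.exp (Real.pi * (∑ k, A k) * |s.im|)) := by
          rw [norm_div]
          gcongr
          · rw [← h.sum_eq]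
            exact norm_sinProd_le h.pos_right
          · exact hsin s him
      _ = c⁻¹ := by field_simp
  have hreflect : ‖normRatio B (1 - b) A (1 - a) (-s)‖ ≤ C :=
    hC (-s) (by simpa using le_neg_of_le_neg hre)
  rw [normRatio_reflect h.pos_left h.pos_right (abs_pos.1 (hφ.trans_le him)), norm_mul, norm_mul,
    norm_div, norm_pow, norm_pow, Complex.norm_real, Real.norm_of_nonneg Real.pi_pos.le]
  have hC0 := (norm_nonneg _).trans hreflect
  gcongr

lemma exists_norm_normRatio_le_exp (h : IsBalanced A a B b) (hφ : 0 < φ) :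
    ∃ K, ∀ s : ℂ, φ ≤ |s.im| →
      ‖normRatio A a B b s‖ ≤ K * Real.exp (Real.pi * (∑ j, B j) * |s.im|) := by
  obtain ⟨M₁, C₁, hC₁⟩ := h.exists_norm_normRatio_le_of_le_re
  obtain ⟨M₂, C₂, hC₂⟩ := h.exists_norm_normRatio_le_of_re_le hφ
  obtain ⟨C₃, hC₃⟩ := exists_norm_normRatio_le_exp_of_abs_re_le h.pos_left h.pos_right a b
    (max M₁ M₂) hφ
  refine ⟨max (max C₁ C₂) C₃, fun s him => ?_⟩
  have hexp : 1 ≤ Real.exp (Real.pi * (∑ j, B j) * |s.im|) := by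
    have := Finset.sum_nonneg fun j (_ : j ∈ Finset.univ) => (h.pos_right j).le
    exact Real.one_le_exp (by positivity)
  rcases le_total (max M₁ M₂) |s.re| with hout | hin
  · have hbound : ‖normRatio A a B b s‖ ≤ max C₁ C₂ := by
      rcases le_abs.1 hout with hre | hre
      · exact (hC₁ s ((le_max_left _ _).trans hre)).trans (le_max_left _ _)
      · exact (hC₂ s (le_neg_of_le_neg ((le_max_right _ _).trans hre)) him).trans
          (le_max_right _ _)
    have hmax := hbound.trans (le_max_left _ C₃)
    exact hmax.trans (le_mul_of_one_le_right ((norm_nonneg _).trans hmax) hexp)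
  · refine (hC₃ s hin him).trans ?_
    gcongr
    exact le_max_right _ _

theorem exists_norm_normRatio_le (h : IsBalanced A a B b) (hφ : 0 < φ) :
    ∃ C, ∀ s : ℂ, φ ≤ |s.im| → ‖normRatio A a B b s‖ ≤ C := by
  obtain ⟨M₁, C₁, hC₁⟩ := h.exists_norm_normRatio_le_of_le_re
  obtain ⟨M₂, C₂, hC₂⟩ := h.exists_norm_normRatio_le_of_re_le hφ
  obtain ⟨K, hK⟩ := h.exists_norm_normRatio_le_exp hφ
  have hD : 0 ≤ Real.pi * ∑ j, B j :=
    mul_nonneg Real.pi_pos.le (Finset.sum_nonneg fun j _ => (h.pos_right j).le)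
  have hd (s : ℂ) (hs : s.im ≠ 0) : DifferentiableAt ℂ (normRatio A a B b) s :=
    differentiableAt_normRatio h.pos_left h.pos_right
      (differentiableAt_gammaProd_of_im_ne_zero h.pos_left hs)
  have habs {s : ℂ} (hs : φ ≤ s.im) : |s.im| = s.im := abs_of_pos (hφ.trans_le hs)
  obtain ⟨C₃, hC₃⟩ := exists_norm_le_of_norm_le_exp (f := normRatio A a B b) hD
    (fun s hs => hd s (hφ.trans_le hs).ne')
    (fun s hre hs => hC₂ s hre (hs.trans_eq (habs hs).symm))
    fun s hs => by simpa only [habs hs] using hK s (hs.trans_eq (habs hs).symm)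
  obtain ⟨C₄, hC₄⟩ := exists_norm_le_of_norm_le_exp (f := fun s => normRatio A a B b (-s)) hD
    (fun s hs => (hd (-s) (by simpa using (hφ.trans_le hs).ne')).comp s (f := fun s => -s)
      (by fun_prop))
    (fun s hre _ => hC₁ (-s) (by simpa using le_neg_of_le_neg hre))
    fun s hs => by simpa [habs hs] using hK (-s) (by simpa [habs hs] using hs)
  refine ⟨max C₃ C₄, fun s hs => ?_⟩
  rcases le_abs.1 hs with him | him
  · exact (hC₃ s him).trans (le_max_left _ _)
  · simpa using (hC₄ (-s) (by simpa using him)).trans (le_max_right C₃ _)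

end IsBalanced

end Ratio

/-! ### Left loop integrals -/

/-- The closed region outside the loop of `leftLoopIntegral c φ₁ φ₂`. -/
def loopExterior (c φ₁ φ₂ : ℝ) : Set ℂ :=
  {s | c ≤ s.re ∨ s.im ∉ Ioo φ₁ φ₂}

lemma loopExterior_anti {c c' : ℝ} (hc : c ≤ c') (φ₁ φ₂ : ℝ) :
    loopExterior c' φ₁ φ₂ ⊆ loopExterior c φ₁ φ₂ :=
  fun _ => Or.imp_left hc.trans

lemma horizontal_lower_mem_loopExterior (c φ₁ φ₂ x : ℝ) :
    (x : ℂ) + φ₁ * Complex.I ∈ loopExterior c φ₁ φ₂ := by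
  simp [loopExterior]

lemma horizontal_upper_mem_loopExterior (c φ₁ φ₂ x : ℝ) :
    (x : ℂ) + φ₂ * Complex.I ∈ loopExterior c φ₁ φ₂ := by
  simp [loopExterior]

lemma vertical_mem_loopExterior (c φ₁ φ₂ y : ℝ) :
    (c : ℂ) + y * Complex.I ∈ loopExterior c φ₁ φ₂ := by
  simp [loopExterior]

section Contour

variable {f g : ℂ → ℂ} {t C c c' y y₁ y₂ φ₁ φ₂ : ℝ}

lemma leftLoopIntegral_congr (h : EqOn f g (loopExterior c φ₁ φ₂)) :
    leftLoopIntegral c φ₁ φ₂ f = leftLoopIntegral c φ₁ φ₂ g := by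
  simp only [leftLoopIntegral, h (horizontal_lower_mem_loopExterior c φ₁ φ₂ _),
    h (horizontal_upper_mem_loopExterior c φ₁ φ₂ _), h (vertical_mem_loopExterior c φ₁ φ₂ _)]

lemma integrableOn_horizontal (ht : 0 < t)
    (hg : ContinuousOn (fun x : ℝ => g (x + y * Complex.I)) (Iic c))
    (hb : ∀ x : ℝ, x ≤ c → ‖g (x + y * Complex.I)‖ ≤ C * Real.exp (t * x)) :
    IntegrableOn (fun x : ℝ => g (x + y * Complex.I)) (Iic c) := by
  refine Integrable.mono' ((integrableOn_exp_mul_Iic ht c).const_mul C)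
    (hg.aestronglyMeasurable measurableSet_Iic) ?_
  filter_upwards [ae_restrict_mem measurableSet_Iic] with x hx using hb x hx

lemma norm_integral_horizontal_le (ht : 0 < t)
    (hb : ∀ x : ℝ, x ≤ c → ‖g (x + y * Complex.I)‖ ≤ C * Real.exp (t * x)) :
    ‖∫ x in Iic c, g (x + y * Complex.I)‖ ≤ C * (Real.exp (t * c) / t) := by
  rw [← integral_exp_mul_Iic ht c, ← integral_const_mul]
  refine norm_integral_le_of_norm_le ((integrableOn_exp_mul_Iic ht c).const_mul C) ?_
  filter_upwards [ae_restrict_mem measurableSet_Iic] with x hx using hb x hx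

lemma leftLoopIntegrable_of_norm_le (ht : 0 < t) (hg : ContinuousOn g (loopExterior c φ₁ φ₂))
    (hb : ∀ s : ℂ, s.im ∉ Ioo φ₁ φ₂ → ‖g s‖ ≤ C * Real.exp (t * s.re)) :
    LeftLoopIntegrable c φ₁ φ₂ g := by
  refine ⟨integrableOn_horizontal (C := C) ht ?_ fun x _ => ?_, ContinuousOn.intervalIntegrable ?_,
    integrableOn_horizontal (C := C) ht ?_ fun x _ => ?_⟩
  · exact hg.comp (by fun_prop) fun x _ => horizontal_lower_mem_loopExterior c φ₁ φ₂ x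
  · simpa using hb (x + φ₁ * Complex.I) (by simp)
  · exact hg.comp (by fun_prop) fun y _ => vertical_mem_loopExterior c φ₁ φ₂ y
  · exact hg.comp (by fun_prop) fun x _ => horizontal_upper_mem_loopExterior c φ₁ φ₂ x
  · simpa using hb (x + φ₂ * Complex.I) (by simp)

lemma integral_boundary_rect_eq_zero (hc : c ≤ c') (hy : y₁ ≤ y₂)
    (hg : DifferentiableOn ℂ g (Icc c c' ×ℂ Icc y₁ y₂)) :
    (∫ x in c..c', g (x + y₁ * Complex.I)) - (∫ x in c..c', g (x + y₂ * Complex.I))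
      + Complex.I * (∫ y in y₁..y₂, g (c' + y * Complex.I))
      - Complex.I * (∫ y in y₁..y₂, g (c + y * Complex.I)) = 0 := by
  have hrect := Complex.integral_boundary_rect_eq_zero_of_differentiableOn g
    (c + y₁ * Complex.I) (c' + y₂ * Complex.I) (by simpa [uIcc_of_le hc, uIcc_of_le hy] using hg)
  simpa using hrect

lemma tendsto_integral_vertical_atBot (ht : 0 < t) (hy : y₁ ≤ y₂)
    (hb : ∀ s ∈ Iic c ×ℂ Icc y₁ y₂, ‖g s‖ ≤ C * Real.exp (t * s.re)) :
    Tendsto (fun x : ℝ => ∫ y in y₁..y₂, g (x + y * Complex.I)) atBot (𝓝 0) := by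
  have hlim : Tendsto (fun x : ℝ => C * Real.exp (t * x) * |y₂ - y₁|) atBot (𝓝 0) := by
    simpa using ((Real.tendsto_exp_atBot.comp (tendsto_id.const_mul_atBot ht)).const_mul
      C).mul_const |y₂ - y₁|
  refine squeeze_zero_norm' ?_ hlim
  filter_upwards [eventually_le_atBot c] with x hx
  refine intervalIntegral.norm_integral_le_of_norm_le_const fun y hy' => ?_
  rw [uIoc_of_le hy] at hy'
  simpa using hb (x + y * Complex.I) (by simpa [Complex.mem_reProdIm] using ⟨hx, hy'.1.le, hy'.2⟩)

lemma leftLoopIntegral_eq_zero (ht : 0 < t) (hy : y₁ ≤ y₂)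
    (hg : DifferentiableOn ℂ g (Iic c ×ℂ Icc y₁ y₂))
    (hb : ∀ s ∈ Iic c ×ℂ Icc y₁ y₂, ‖g s‖ ≤ C * Real.exp (t * s.re)) :
    leftLoopIntegral c y₁ y₂ g = 0 := by
  have hlim (y : ℝ) (hy' : y ∈ Icc y₁ y₂) : Tendsto
      (fun a : ℝ => ∫ x in a..c, g (x + y * Complex.I)) atBot
      (𝓝 (∫ x in Iic c, g (x + y * Complex.I))) := by
    have hmem (x : ℝ) (hx : x ≤ c) : (x : ℂ) + y * Complex.I ∈ Iic c ×ℂ Icc y₁ y₂ := by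
      simpa [Complex.mem_reProdIm] using ⟨hx, hy'⟩
    refine intervalIntegral_tendsto_integral_Iic c (integrableOn_horizontal (C := C) ht
      (hg.continuousOn.comp (by fun_prop) hmem) fun x hx => ?_) tendsto_id
    simpa using hb _ (hmem x hx)
  have hrect : ∀ᶠ a : ℝ in atBot, (∫ x in a..c, g (x + y₁ * Complex.I))
      - (∫ x in a..c, g (x + y₂ * Complex.I))
      + Complex.I * (∫ y in y₁..y₂, g (c + y * Complex.I))
      - Complex.I * (∫ y in y₁..y₂, g (a + y * Complex.I)) = 0 := by
    filter_upwards [eventually_le_atBot c] with a ha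
    exact integral_boundary_rect_eq_zero ha hy
      (hg.mono (Complex.reProdIm_subset_iff.2 (prod_mono_left Icc_subset_Iic_self)))
  have hsum := (((hlim y₁ (left_mem_Icc.2 hy)).sub (hlim y₂ (right_mem_Icc.2 hy))).add_const
    (Complex.I * (∫ y in y₁..y₂, g (c + y * Complex.I)))).sub
    ((tendsto_integral_vertical_atBot ht hy hb).const_mul Complex.I)
  have hzero := tendsto_nhds_unique (hsum.congr' hrect) tendsto_const_nhds
  rw [leftLoopIntegral]
  linear_combination hzero

lemma leftLoopIntegral_shift (hc : c ≤ c') (hφ : φ₁ ≤ φ₂)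
    (hg : DifferentiableOn ℂ g (Icc c c' ×ℂ Icc φ₁ φ₂)) (hi : LeftLoopIntegrable c' φ₁ φ₂ g) :
    leftLoopIntegral c φ₁ φ₂ g = leftLoopIntegral c' φ₁ φ₂ g := by
  have hsub := Iic_subset_Iic.2 hc
  have hlower := intervalIntegral.integral_Iic_sub_Iic (hi.1.mono_set hsub) hi.1
  have hupper := intervalIntegral.integral_Iic_sub_Iic (hi.2.2.mono_set hsub) hi.2.2
  rw [leftLoopIntegral, leftLoopIntegral]
  linear_combination -hlower + hupper - integral_boundary_rect_eq_zero hc hφ hg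

lemma integrable_vertical (hg : ContinuousOn g (loopExterior c φ₁ φ₂))
    (hb : ∀ s ∈ loopExterior c φ₁ φ₂, s.re ≤ c →
      ‖g s‖ ≤ C / (1 + s.im ^ 2) * Real.exp (t * s.re)) :
    Integrable fun y : ℝ => g (c + y * Complex.I) := by
  refine Integrable.mono' ((integrable_inv_one_add_sq.const_mul C).mul_const (Real.exp (t * c)))
    ?_ (ae_of_all _ fun y => ?_)
  · exact (hg.comp_continuous (by fun_prop)
      (vertical_mem_loopExterior c φ₁ φ₂)).aestronglyMeasurable
  · simpa [div_eq_mul_inv] using hb _ (vertical_mem_loopExterior c φ₁ φ₂ y) (by simp)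

lemma tendsto_integral_horizontal_cobounded (ht : 0 < t)
    (hb : ∀ s ∈ loopExterior c φ₁ φ₂, s.re ≤ c →
      ‖g s‖ ≤ C / (1 + s.im ^ 2) * Real.exp (t * s.re)) :
    Tendsto (fun y : ℝ => ∫ x in Iic c, g (x + y * Complex.I)) (Bornology.cobounded ℝ) (𝓝 0) := by
  have hlim : Tendsto (fun y : ℝ => C / (1 + y ^ 2) * (Real.exp (t * c) / t))
      (Bornology.cobounded ℝ) (𝓝 0) := by
    have hsq : Tendsto (fun y : ℝ => 1 + |y| ^ 2) (Bornology.cobounded ℝ) atTop :=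
      tendsto_atTop_add_const_left _ _
        ((tendsto_pow_atTop two_ne_zero).comp tendsto_norm_cobounded_atTop)
    simpa only [sq_abs, zero_mul] using
      (hsq.const_div_atTop C).mul_const (Real.exp (t * c) / t)
  refine squeeze_zero_norm' ?_ hlim
  filter_upwards [Bornology.isBounded_def.1 (Metric.isBounded_Ioo φ₁ φ₂)] with y hy
  refine norm_integral_horizontal_le ht fun x hx => ?_
  simpa using hb (x + y * Complex.I) (Or.inr (by simpa [mem_compl_iff] using hy))
    (by simpa using hx)

/-- The loop differs from the vertical line through its side by the boundaries of the two left
quarter-planes above and below it. -/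
lemma leftLoopIntegral_eq_vertical (ht : 0 < t)
    (hg : DifferentiableOn ℂ g (loopExterior c φ₁ φ₂))
    (hb : ∀ s ∈ loopExterior c φ₁ φ₂, s.re ≤ c →
      ‖g s‖ ≤ C / (1 + s.im ^ 2) * Real.exp (t * s.re)) :
    leftLoopIntegral c φ₁ φ₂ g = Complex.I * ∫ y : ℝ, g (c + y * Complex.I) := by
  have hi := integrable_vertical hg.continuousOn hb
  have hC : 0 ≤ C := by
    have hnn := (norm_nonneg _).trans (hb _ (vertical_mem_loopExterior c φ₁ φ₂ 0) (by simp))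
    exact nonneg_of_mul_nonneg_left (by simpa using hnn) (Real.exp_pos (t * c))
  have hstrip (y₁ y₂ : ℝ) (hy : y₁ ≤ y₂) (hout : ∀ y ∈ Icc y₁ y₂, y ∉ Ioo φ₁ φ₂) :
      leftLoopIntegral c y₁ y₂ g = 0 := by
    have hsub : Iic c ×ℂ Icc y₁ y₂ ⊆ loopExterior c φ₁ φ₂ := fun s hs => Or.inr (hout _ hs.2)
    refine leftLoopIntegral_eq_zero (C := C) ht hy (hg.mono hsub) fun s hs =>
      (hb s (hsub hs) hs.1).trans ?_
    gcongr
    exact div_le_self hC (by nlinarith)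
  have hloop : ∀ᶠ R : ℝ in atTop, Complex.I * (∫ y in (-R)..R, g (c + y * Complex.I))
      + (∫ x in Iic c, g (x + (-R : ℝ) * Complex.I)) - (∫ x in Iic c, g (x + R * Complex.I))
      = leftLoopIntegral c φ₁ φ₂ g := by
    filter_upwards [eventually_ge_atTop φ₂, eventually_ge_atTop (-φ₁)] with R hR₂ hR₁
    have hupper := hstrip φ₂ R hR₂ fun y hy h => hy.1.not_gt h.2
    have hlower := hstrip (-R) φ₁ (neg_le.1 hR₁) fun y hy h => hy.2.not_gt h.1
    rw [leftLoopIntegral] at hupper hlower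
    rw [leftLoopIntegral,
      ← intervalIntegral.integral_add_adjacent_intervals (b := φ₂) hi.intervalIntegrable
        hi.intervalIntegrable,
      ← intervalIntegral.integral_add_adjacent_intervals (a := -R) (b := φ₁) hi.intervalIntegrable
        hi.intervalIntegrable]
    linear_combination hupper + hlower
  have hhor := tendsto_integral_horizontal_cobounded ht hb
  have hlim := (((intervalIntegral_tendsto_integral hi tendsto_neg_atTop_atBot
    tendsto_id).const_mul Complex.I).add (hhor.comp (tendsto_neg_atTop_atBot.mono_right
    IsOrderBornology.atBot_le_cobounded))).sub (hhor.mono_left IsOrderBornology.atTop_le_cobounded)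
  simpa using (tendsto_nhds_unique (hlim.congr' hloop) tendsto_const_nhds).symm

end Contour

section Derivative

variable {f : ℂ → ℂ} {c C φ₁ φ₂ t : ℝ}

lemma norm_cexp_ofReal_mul (t : ℝ) (z : ℂ) :
    ‖Complex.exp (t * z)‖ = Real.exp (t * z.re) := by
  rw [Complex.norm_exp, Complex.re_ofReal_mul]

lemma exp_mul_le_of_mem_Ioo {r t₀ : ℝ} (hc : 0 ≤ c) (hr : r ≤ c) (ht₀ : 0 < t₀)
    (ht : t ∈ Ioo (t₀ / 2) (2 * t₀)) :
    Real.exp (t * r) ≤ Real.exp (2 * t₀ * c) * Real.exp (t₀ / 2 * r) := by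
  rw [← Real.exp_add]
  refine Real.exp_le_exp.2 ?_
  nlinarith [mul_nonneg (sub_nonneg.2 ht.1.le) (sub_nonneg.2 hr),
    mul_nonneg (sub_nonneg.2 ht.2.le) hc, mul_nonneg ht₀.le hc]

lemma hasDerivAt_setIntegral_mul_cexp {S : Set ℝ} (hS : MeasurableSet S) {E : Set ℂ} {γ : ℝ → ℂ}
    (hγ : Continuous γ) (hγE : MapsTo γ S E) (hc : 0 ≤ c) (hre : ∀ x ∈ S, (γ x).re ≤ c)
    (hf : ContinuousOn f E) (hb : ∀ s ∈ E, ‖f s‖ ≤ C) (hb' : ∀ s ∈ E, ‖s * f s‖ ≤ C)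
    (hinteg : ∀ t : ℝ, 0 < t → IntegrableOn (fun x => Real.exp (t * (γ x).re)) S) (ht : 0 < t) :
    HasDerivAt (fun t : ℝ => ∫ x in S, f (γ x) * Complex.exp (t * γ x))
      (∫ x in S, γ x * f (γ x) * Complex.exp (t * γ x)) t := by
  have hfγ : AEStronglyMeasurable (fun x => f (γ x)) (volume.restrict S) :=
    (hf.comp hγ.continuousOn hγE).aestronglyMeasurable hS
  have hexp (u : ℝ) : AEStronglyMeasurable (fun x => Complex.exp (u * γ x)) (volume.restrict S) :=
    (by fun_prop : Continuous fun x => Complex.exp (u * γ x)).aestronglyMeasurable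
  refine (hasDerivAt_integral_of_dominated_loc_of_deriv_le
    (F := fun (u : ℝ) x => f (γ x) * Complex.exp (u * γ x))
    (F' := fun (u : ℝ) x => γ x * f (γ x) * Complex.exp (u * γ x))
    (bound := fun x => C * (Real.exp (2 * t * c) * Real.exp (t / 2 * (γ x).re)))
    (Ioo_mem_nhds (half_lt_self ht) (lt_two_mul_self ht))
    (Eventually.of_forall fun u => hfγ.mul (hexp u)) ?_
    ((hγ.aestronglyMeasurable.mul hfγ).mul (hexp t)) ?_
    (((hinteg _ (half_pos ht)).const_mul _).const_mul _) ?_).2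
  · refine ((hinteg t ht).const_mul C).mono' (hfγ.mul (hexp t)) ?_
    filter_upwards [ae_restrict_mem hS] with x hx
    rw [norm_mul, norm_cexp_ofReal_mul]
    gcongr
    exact hb _ (hγE hx)
  · filter_upwards [ae_restrict_mem hS] with x hx u hu
    rw [norm_mul, norm_cexp_ofReal_mul]
    have hle := hb' _ (hγE hx)
    exact mul_le_mul hle (exp_mul_le_of_mem_Ioo hc (hre x hx) ht hu) (Real.exp_pos _).le
      ((norm_nonneg _).trans hle)
  · refine ae_of_all _ fun x u _ => ?_
    have hmul : HasDerivAt (fun u : ℝ => (u : ℂ) * γ x) (1 * γ x) u :=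
      (Complex.ofRealCLM.hasDerivAt (x := u)).mul_const (γ x)
    exact (hmul.cexp.const_mul (f (γ x))).congr_deriv (by ring)

lemma hasDerivAt_leftLoopIntegral (hc : 0 ≤ c) (hφ : φ₁ ≤ φ₂)
    (hf : ContinuousOn f (loopExterior c φ₁ φ₂)) (hb : ∀ s ∈ loopExterior c φ₁ φ₂, ‖f s‖ ≤ C)
    (hb' : ∀ s ∈ loopExterior c φ₁ φ₂, ‖s * f s‖ ≤ C) (ht : 0 < t) :
    HasDerivAt (fun t : ℝ => leftLoopIntegral c φ₁ φ₂ fun s => f s * Complex.exp (t * s))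
      (leftLoopIntegral c φ₁ φ₂ fun s => s * f s * Complex.exp (t * s)) t := by
  have hhor (φ : ℝ) (hφ : ∀ x : ℝ, (x : ℂ) + φ * Complex.I ∈ loopExterior c φ₁ φ₂) :=
    hasDerivAt_setIntegral_mul_cexp (measurableSet_Iic (a := c))
      (γ := fun x : ℝ => (x : ℂ) + φ * Complex.I) (by fun_prop) (fun x _ => hφ x) hc
      (fun x hx => by simpa using hx) hf hb hb'
      (fun t ht => by simpa using integrableOn_exp_mul_Iic ht c) ht
  have hver := hasDerivAt_setIntegral_mul_cexp (measurableSet_Ioc (a := φ₁) (b := φ₂))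
    (γ := fun y : ℝ => (c : ℂ) + y * Complex.I) (by fun_prop)
    (fun y _ => vertical_mem_loopExterior c φ₁ φ₂ y) hc (fun y _ => by simp) hf hb hb'
    (fun t _ => by simp) ht
  simp only [← intervalIntegral.integral_of_le hφ] at hver
  exact ((hhor φ₁ (horizontal_lower_mem_loopExterior c φ₁ φ₂)).fun_add
    (hver.const_mul Complex.I)).fun_sub (hhor φ₂ (horizontal_upper_mem_loopExterior c φ₁ φ₂))

end Derivative

/-! ### Inversion of the Laplace transform along a loop -/

/-- The antiderivative of `h` with value `ν` at `0`, that is, the antiderivative of `ν δ₀ + h`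
on the half-line. -/
noncomputable def primitive (ν : ℝ) (h : ℝ → ℝ) (t : ℝ) : ℝ :=
  ν + ∫ u in (0 : ℝ)..t, h u

section Primitive

variable {h : ℝ → ℝ} {m : ℝ}

lemma hasDerivAt_primitive (hc : Continuous h) (ν t : ℝ) : HasDerivAt (primitive ν h) (h t) t :=
  (intervalIntegral.integral_hasDerivAt_right (hc.intervalIntegrable _ _)
    (hc.stronglyMeasurableAtFilter _ _) hc.continuousAt).const_add ν

lemma continuous_primitive (hc : Continuous h) (ν : ℝ) : Continuous (primitive ν h) :=
  continuous_iff_continuousAt.2 fun t => (hasDerivAt_primitive hc ν t).continuousAt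

lemma expBounded_const (ν : ℝ) (hm : 0 ≤ m) : ExpBounded m fun _ => ν :=
  ⟨continuousOn_const, |ν|, abs_nonneg ν, fun _ ht =>
    le_mul_of_one_le_right (abs_nonneg ν) (Real.one_le_exp (mul_nonneg hm ht.le))⟩

lemma expBounded_primitive (hh : ExpBounded m h) (hc : Continuous h) (hm : 0 < m) (ν : ℝ) :
    ExpBounded m (primitive ν h) := by
  obtain ⟨C, hC0, hC⟩ := hh.bound
  refine ⟨(continuous_primitive hc ν).continuousOn, |ν| + C / m, by positivity, fun t ht => ?_⟩
  have hinteg : |∫ u in (0 : ℝ)..t, h u| ≤ C / m * Real.exp (m * t) :=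
    calc |∫ u in (0 : ℝ)..t, h u| ≤ ∫ u in (0 : ℝ)..t, C * Real.exp (m * u) :=
          Real.norm_eq_abs (∫ u in (0 : ℝ)..t, h u) ▸
            intervalIntegral.norm_integral_le_of_norm_le ht.le (ae_of_all _ fun u hu => hC u hu.1)
            ((by fun_prop : Continuous fun u => C * Real.exp (m * u)).intervalIntegrable _ _)
      _ = C / m * (Real.exp (m * t) - 1) := by
          rw [intervalIntegral.integral_const_mul, intervalIntegral.integral_comp_mul_left _ hm.ne',
            integral_exp, mul_zero, Real.exp_zero, smul_eq_mul]
          ring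
      _ ≤ C / m * Real.exp (m * t) := by
          gcongr
          exact sub_le_self _ zero_le_one
  calc |primitive ν h t| ≤ |ν| + |∫ u in (0 : ℝ)..t, h u| := abs_add_le _ _
    _ ≤ |ν| * Real.exp (m * t) + C / m * Real.exp (m * t) := by
        gcongr
        exact le_mul_of_one_le_right (abs_nonneg ν) (Real.one_le_exp (by positivity))
    _ = (|ν| + C / m) * Real.exp (m * t) := by ring

lemma laplace_const (ν : ℝ) {s : ℂ} (hs : 0 < s.re) : laplace (fun _ => ν) s = ν / s := by
  rw [laplace, integral_const_mul, integral_exp_mul_complex_Ioi (by simpa using hs)]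
  simp [div_eq_mul_inv]

lemma laplace_primitive (hh : ExpBounded m h) (hc : Continuous h) (hm : 0 < m) (ν : ℝ)
    {s : ℂ} (hs : m < s.re) : laplace (primitive ν h) s = (ν + laplace h s) / s := by
  have hzero : primitive 0 h = fun t => ∫ u in (0 : ℝ)..t, h u := funext fun _ => zero_add _
  have hinteg := hzero ▸ expBounded_primitive hh hc hm 0
  have hconv := hh.laplace_convolution (expBounded_const 1 hm.le) hs
  simp only [mul_one, laplace_const 1 (hm.trans hs), Complex.ofReal_one] at hconv
  have hadd := (expBounded_const ν hm.le).laplace_add hinteg hs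
  rw [hconv, laplace_const ν (hm.trans hs)] at hadd
  exact hadd.trans (by ring)

end Primitive

section Inversion

variable {f : ℝ → ℝ} {m c t : ℝ}

lemma fourier_indicator_eq_laplace (f : ℝ → ℝ) (c ξ : ℝ) :
    𝓕 ((Ioi (0 : ℝ)).indicator fun t : ℝ => (f t : ℂ) * Complex.exp (-(c : ℂ) * t)) ξ
      = laplace f (c + (2 * Real.pi * ξ : ℝ) * Complex.I) := by
  rw [Real.fourier_real_eq_integral_exp_smul, laplace, ← integral_indicator measurableSet_Ioi]
  congr 1
  ext v
  by_cases hv : v ∈ Ioi (0 : ℝ)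
  · rw [indicator_of_mem hv, indicator_of_mem hv, smul_eq_mul, mul_left_comm, ← Complex.exp_add]
    congr 2
    push_cast
    ring
  · rw [indicator_of_notMem hv, indicator_of_notMem hv, smul_zero]

lemma ExpBounded.eq_integral_laplace (hf : ExpBounded m f) (hc : m < c)
    (hi : Integrable fun y : ℝ => laplace f (c + y * Complex.I)) (ht : 0 < t) :
    (f t : ℂ) = 1 / (2 * Real.pi) *
      ∫ y : ℝ, laplace f (c + y * Complex.I) * Complex.exp (t * (c + y * Complex.I)) := by
  set F : ℝ → ℂ := (Ioi 0).indicator fun t => (f t : ℂ) * Complex.exp (-(c : ℂ) * t)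
  have hFt : F =ᶠ[𝓝 t] fun t => (f t : ℂ) * Complex.exp (-(c : ℂ) * t) :=
    (eqOn_indicator (s := Ioi 0)).eventuallyEq_of_mem (Ioi_mem_nhds ht)
  have hFint : Integrable F :=
    (integrable_indicator_iff measurableSet_Ioi).2 (hf.integrableOn_laplaceIntegrand (by simpa))
  have hfourier : 𝓕 F = fun ξ : ℝ => laplace f (c + (2 * Real.pi * ξ : ℝ) * Complex.I) :=
    funext (fourier_indicator_eq_laplace f c)
  have hcont : ContinuousAt F t :=
    ((Complex.continuous_ofReal.continuousAt.comp (hf.continuousOn.continuousAt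
      (Ioi_mem_nhds ht))).mul (by fun_prop)).congr hFt.symm
  have hinv := hFint.fourierInv_fourier_eq
    (by rw [hfourier]; exact hi.comp_mul_left' Real.two_pi_pos.ne') hcont
  have hscale := Measure.integral_comp_mul_left (fun y : ℝ =>
    laplace f (c + y * Complex.I) * Complex.exp (t * (c + y * Complex.I))) (2 * Real.pi)
  rw [abs_of_pos (inv_pos.2 Real.two_pi_pos), Complex.real_smul] at hscale
  calc (f t : ℂ) = Complex.exp (c * t) * F t := by
        rw [hFt.eq_of_nhds, mul_left_comm, ← Complex.exp_add]
        simp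
    _ = ∫ ξ : ℝ, laplace f (c + (2 * Real.pi * ξ : ℝ) * Complex.I)
          * Complex.exp (t * (c + (2 * Real.pi * ξ : ℝ) * Complex.I)) := by
        rw [← hinv, Real.fourierInv_eq', hfourier, ← integral_const_mul]
        congr 1
        ext ξ
        simp only [RCLike.inner_apply, conj_trivial, smul_eq_mul]
        rw [← mul_assoc, ← Complex.exp_add, mul_comm]
        congr 2
        push_cast
        ring
    _ = _ := by
        rw [hscale]
        push_cast
        ring

end Inversion

section LoopInversion

variable {f G : ℂ → ℂ} {h w w' : ℝ → ℝ} {m ν σ c C φ₁ φ₂ t : ℝ}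

lemma leftLoopIntegral_mul_cexp_of_eq_laplace (hw : ExpBounded m w) (hm : m < c)
    (hf : DifferentiableOn ℂ f (loopExterior c φ₁ φ₂))
    (hb : ∀ s ∈ loopExterior c φ₁ φ₂, ‖f s‖ ≤ C / (1 + s.im ^ 2))
    (hfw : ∀ s : ℂ, m < s.re → f s = laplace w s) (ht : 0 < t) :
    leftLoopIntegral c φ₁ φ₂ (fun s => f s * Complex.exp (t * s))
      = 2 * Real.pi * Complex.I * w t := by
  have hvert (y : ℝ) : f (c + y * Complex.I) = laplace w (c + y * Complex.I) :=
    hfw _ (by simpa using hm)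
  have hinteg : Integrable fun y : ℝ => laplace w (c + y * Complex.I) := by
    simpa only [hvert] using integrable_vertical (t := 0) hf.continuousOn
      fun s hs _ => by simpa using hb s hs
  have hline := leftLoopIntegral_eq_vertical (g := fun s => f s * Complex.exp (t * s)) ht
    (hf.mul (by fun_prop)) fun s hs _ => by
      rw [norm_mul, norm_cexp_ofReal_mul]
      gcongr
      exact hb s hs
  rw [hline, hw.eq_integral_laplace hm hinteg ht]
  simp only [hvert]
  field

lemma leftLoopIntegral_mul_cexp_of_hasDerivAt (hc : 0 ≤ c) (hφ : φ₁ ≤ φ₂)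
    (hf : ContinuousOn f (loopExterior c φ₁ φ₂)) (hb : ∀ s ∈ loopExterior c φ₁ φ₂, ‖f s‖ ≤ C)
    (hb' : ∀ s ∈ loopExterior c φ₁ φ₂, ‖s * f s‖ ≤ C) (hw : ∀ t, HasDerivAt w (w' t) t) {K : ℂ}
    (hfw : ∀ t : ℝ, 0 < t →
      leftLoopIntegral c φ₁ φ₂ (fun s => f s * Complex.exp (t * s)) = K * w t) (ht : 0 < t) :
    leftLoopIntegral c φ₁ φ₂ (fun s => s * f s * Complex.exp (t * s)) = K * w' t :=
  (hasDerivAt_leftLoopIntegral hc hφ hf hb hb' ht).unique <|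
    ((hw t).ofReal_comp.const_mul K).congr_of_eventuallyEq <|
      mem_of_superset (Ioi_mem_nhds ht) hfw

lemma exists_le_norm_of_mem_loopExterior (hc : 0 < c) (h₁ : φ₁ < 0) (h₂ : 0 < φ₂) :
    ∃ δ, 0 < δ ∧ ∀ s ∈ loopExterior c φ₁ φ₂, δ ≤ ‖s‖ := by
  refine ⟨min c (min (-φ₁) φ₂), by simp [hc, h₁, h₂], fun s hs => ?_⟩
  rcases hs with hre | him
  · exact (min_le_left _ _).trans ((hre.trans (le_abs_self _)).trans (Complex.abs_re_le_norm s))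
  · refine (min_le_right _ _).trans (le_trans ?_ (Complex.abs_im_le_norm s))
    rcases le_or_gt s.im φ₁ with hle | hgt
    · exact (min_le_left _ _).trans ((neg_le_neg hle).trans (neg_le_abs _))
    · exact (min_le_right _ _).trans ((not_lt.1 fun h => him ⟨hgt, h⟩).trans (le_abs_self _))

lemma exists_norm_div_sq_le (hc : 0 < c) (h₁ : φ₁ < 0) (h₂ : 0 < φ₂)
    (hb : ∀ s ∈ loopExterior c φ₁ φ₂, ‖G s‖ ≤ C) :
    ∃ C', ∀ s ∈ loopExterior c φ₁ φ₂, ‖G s / s ^ 2‖ ≤ C' / (1 + s.im ^ 2) ∧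
      ‖G s / s‖ ≤ C' := by
  obtain ⟨δ, hδ, hle⟩ := exists_le_norm_of_mem_loopExterior hc h₁ h₂
  have hC : 0 ≤ C := (norm_nonneg _).trans (hb _ (vertical_mem_loopExterior c φ₁ φ₂ 0))
  refine ⟨C * (1 + 1 / δ ^ 2) + C / δ, fun s hs => ⟨?_, ?_⟩⟩
  · have hs₀ : 0 < ‖s‖ := hδ.trans_le (hle s hs)
    have him : s.im ^ 2 ≤ ‖s‖ ^ 2 := sq_le_sq' (neg_le_of_abs_le (Complex.abs_im_le_norm s))
      ((le_abs_self _).trans (Complex.abs_im_le_norm s))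
    have hone : 1 ≤ 1 / δ ^ 2 * ‖s‖ ^ 2 := by
      rw [one_div, inv_mul_eq_div, one_le_div (by positivity)]
      exact pow_le_pow_left₀ hδ.le (hle s hs) 2
    rw [norm_div, norm_pow, div_le_div_iff₀ (by positivity) (by positivity)]
    calc ‖G s‖ * (1 + s.im ^ 2) ≤ C * ((1 + 1 / δ ^ 2) * ‖s‖ ^ 2) := by
          gcongr
          · exact hb s hs
          · linarith
      _ ≤ (C * (1 + 1 / δ ^ 2) + C / δ) * ‖s‖ ^ 2 := by
          rw [← mul_assoc]
          gcongr
          exact le_add_of_nonneg_right (by positivity)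
  · calc ‖G s / s‖ ≤ C / δ := by
          rw [norm_div]
          gcongr
          exacts [hb s hs, hle s hs]
      _ ≤ C * (1 + 1 / δ ^ 2) + C / δ := le_add_of_nonneg_left (by positivity)

/-- Dividing `G` by `s ^ 2` makes its integral along a vertical line converge; two derivatives in
`t` undo the division. -/
lemma leftLoopIntegral_mul_cexp_of_eq_add_laplace (hhc : Continuous h) (hh : ExpBounded σ h)
    (hσ : 0 < σ) (hc : σ < c) (h₁ : φ₁ < 0) (h₂ : 0 < φ₂)
    (hG : DifferentiableOn ℂ G (loopExterior c φ₁ φ₂))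
    (hb : ∀ s ∈ loopExterior c φ₁ φ₂, ‖G s‖ ≤ C)
    (hGh : ∀ s : ℂ, σ < s.re → G s = ν + laplace h s) (ht : 0 < t) :
    leftLoopIntegral c φ₁ φ₂ (fun s => G s * Complex.exp (t * s))
      = 2 * Real.pi * Complex.I * h t := by
  have hc₀ : 0 < c := hσ.trans hc
  have hφ : φ₁ ≤ φ₂ := (h₁.trans h₂).le
  obtain ⟨δ, hδ, hle⟩ := exists_le_norm_of_mem_loopExterior hc₀ h₁ h₂
  have hne : ∀ s ∈ loopExterior c φ₁ φ₂, s ≠ 0 := fun s hs =>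
    norm_pos_iff.1 (hδ.trans_le (hle s hs))
  obtain ⟨C', hC'⟩ := exists_norm_div_sq_le hc₀ h₁ h₂ hb
  have hdiv : EqOn (fun s => s * (G s / s ^ 2)) (fun s => G s / s) (loopExterior c φ₁ φ₂) :=
    fun s hs => by have := hne s hs; field
  have hmul : EqOn (fun s => s * (G s / s)) G (loopExterior c φ₁ φ₂) :=
    fun s hs => mul_div_cancel₀ _ (hne s hs)
  have hd : DifferentiableOn ℂ (fun s => G s / s) (loopExterior c φ₁ φ₂) :=
    hG.div differentiableOn_id hne
  have hd₂ : DifferentiableOn ℂ (fun s => G s / s ^ 2) (loopExterior c φ₁ φ₂) :=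
    hG.div (by fun_prop) fun s hs => pow_ne_zero 2 (hne s hs)
  have hprim := expBounded_primitive hh hhc hσ ν
  have hzero (t : ℝ) (ht : 0 < t) :=
    leftLoopIntegral_mul_cexp_of_eq_laplace (expBounded_primitive hprim
      (continuous_primitive hhc ν) hσ 0) hc hd₂ (fun s hs => (hC' s hs).1) (fun s hs => by
        rw [laplace_primitive hprim (continuous_primitive hhc ν) hσ 0 hs,
          laplace_primitive hh hhc hσ ν hs, hGh s hs, Complex.ofReal_zero, zero_add, div_div, sq])
      ht
  have hone (t : ℝ) (ht : 0 < t) : leftLoopIntegral c φ₁ φ₂ (fun s => G s / s * Complex.exp (t * s))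
      = 2 * Real.pi * Complex.I * primitive ν h t := by
    rw [← leftLoopIntegral_mul_cexp_of_hasDerivAt hc₀.le hφ hd₂.continuousOn (C := C')
      (fun s hs => (hC' s hs).1.trans ?_) (fun s hs => ?_)
      (hasDerivAt_primitive (continuous_primitive hhc ν) 0) hzero ht]
    · exact leftLoopIntegral_congr fun s hs => congrArg (· * _) (hdiv hs).symm
    · exact div_le_self ((norm_nonneg _).trans (hC' s hs).2) (by nlinarith)
    · exact (congrArg norm (hdiv hs)).trans_le (hC' s hs).2
  rw [← leftLoopIntegral_mul_cexp_of_hasDerivAt hc₀.le hφ hd.continuousOn (C := max C C')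
      (fun s hs => le_max_of_le_right (hC' s hs).2)
      (fun s hs => (congrArg norm (hmul hs)).trans_le (le_max_of_le_left (hb s hs)))
      (hasDerivAt_primitive hhc ν) hone ht]
  exact leftLoopIntegral_congr fun s hs => congrArg (· * _) (hmul hs).symm

lemma leftLoopIntegrable_mul_cexp (hG : ContinuousOn G (loopExterior c φ₁ φ₂))
    (hb : ∀ s : ℂ, s.im ∉ Ioo φ₁ φ₂ → ‖G s‖ ≤ C) (ht : 0 < t) :
    LeftLoopIntegrable c φ₁ φ₂ fun s => G s * Complex.exp (t * s) :=
  leftLoopIntegrable_of_norm_le ht (hG.mul (by fun_prop)) fun s hs => by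
    rw [norm_mul, norm_cexp_ofReal_mul]
    gcongr
    exact hb s hs

lemma exists_norm_le_of_eq_add_laplace (hh : ExpBounded σ h)
    (hb : ∀ s : ℂ, s.im ∉ Ioo φ₁ φ₂ → ‖G s‖ ≤ C)
    (hGh : ∀ s : ℂ, σ < s.re → G s = ν + laplace h s) :
    ∃ C', ∀ s ∈ loopExterior (σ + 1) φ₁ φ₂, ‖G s‖ ≤ C' := by
  obtain ⟨C', hC'₀, hC'⟩ := hh.exists_norm_laplace_le
  refine ⟨max C (‖(ν : ℂ)‖ + C'), ?_⟩
  rintro s (hre | him)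
  · have hs : σ < s.re := (lt_add_one σ).trans_le hre
    rw [hGh s hs]
    exact le_max_of_le_right <| norm_add_le_of_le le_rfl <|
      (hC' s hs).trans (div_le_self hC'₀ (le_sub_iff_add_le'.2 hre))
  · exact le_max_of_le_left (hb s him)

lemma leftLoopIntegral_mul_cexp (hhc : Continuous h) (hh : ExpBounded σ h) (hσ : 0 < σ)
    (h₁ : φ₁ < 0) (h₂ : 0 < φ₂) (hG : DifferentiableOn ℂ G (loopExterior c φ₁ φ₂))
    (hb : ∀ s : ℂ, s.im ∉ Ioo φ₁ φ₂ → ‖G s‖ ≤ C)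
    (hGh : ∀ s : ℂ, σ < s.re → G s = ν + laplace h s) (ht : 0 < t) :
    leftLoopIntegral c φ₁ φ₂ (fun s => G s * Complex.exp (t * s))
      = 2 * Real.pi * Complex.I * h t := by
  obtain ⟨C', hC'⟩ := exists_norm_le_of_eq_add_laplace hh hb hGh
  have hc : c ≤ max c (σ + 1) := le_max_left _ _
  have hσc : σ + 1 ≤ max c (σ + 1) := le_max_right _ _
  have hG' := hG.mono (loopExterior_anti hc φ₁ φ₂)
  rw [leftLoopIntegral_shift hc (h₁.trans h₂).le
    ((hG.mono fun s hs => Or.inl hs.1.1).fun_mul (by fun_prop))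
    (leftLoopIntegrable_mul_cexp hG'.continuousOn hb ht)]
  exact leftLoopIntegral_mul_cexp_of_eq_add_laplace hhc hh hσ ((lt_add_one σ).trans_le hσc) h₁ h₂
    hG' (fun s hs => hC' s (loopExterior_anti hσc φ₁ φ₂ hs)) hGh ht

end LoopInversion

/-! ### Fox's function -/

section Fox

variable {p q : ℕ} {A a : Fin p → ℝ} {B b : Fin q → ℝ} {c φ₁ φ₂ x u : ℝ}

lemma integrand_eq_normRatio_mul_cexp (hA : ∀ k, 0 < A k) (hB : ∀ j, 0 < B j) (hx : 0 < x) :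
    integrand A a B b x
      = fun s => normRatio A a B b s * Complex.exp (Real.log (rho A B / x) * s) := by
  ext s
  rw [integrand, normRatio_eq_mul_exp hA hB, Complex.cpow_def_of_ne_zero (by exact_mod_cast hx.ne'),
    ← Complex.ofReal_log hx.le, mul_assoc, ← Complex.exp_add,
    Real.log_div (rho_pos hA hB).ne' hx.ne']
  congr 2
  push_cast
  ring

lemma IsAdmissibleLoop.differentiableOn_normRatio (hloop : IsAdmissibleLoop A a c φ₁ φ₂)
    (hA : ∀ k, 0 < A k) (hB : ∀ j, 0 < B j) :
    DifferentiableOn ℂ (normRatio A a B b) (loopExterior c φ₁ φ₂) := by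
  intro s hs
  refine (differentiableAt_normRatio hA hB ?_).differentiableWithinAt
  rcases hs with hre | him
  · exact differentiableAt_gammaProd_of_lt_re hA fun k => (hloop.2.2 k).trans_le hre
  · exact differentiableAt_gammaProd_of_im_ne_zero hA fun h₀ =>
      him (h₀ ▸ ⟨hloop.1, hloop.2.1⟩)

lemma IsBalanced.exists_norm_normRatio_le_of_im_notMem (h : IsBalanced A a B b) (h₁ : φ₁ < 0)
    (h₂ : 0 < φ₂) : ∃ C, ∀ s : ℂ, s.im ∉ Ioo φ₁ φ₂ → ‖normRatio A a B b s‖ ≤ C := by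
  obtain ⟨C, hC⟩ := h.exists_norm_normRatio_le (lt_min (neg_pos.2 h₁) h₂)
  refine ⟨C, fun s hs => hC s ?_⟩
  rcases le_or_gt s.im φ₁ with hle | hgt
  · exact (min_le_left _ _).trans ((neg_le_neg hle).trans (neg_le_abs _))
  · exact (min_le_right _ _).trans ((not_lt.1 fun h => hs ⟨hgt, h⟩).trans (le_abs_self _))

lemma IsBalanced.exists_foxH_eq (hbal : IsBalanced A a B b)
    (hloop : IsAdmissibleLoop A a c φ₁ φ₂) :
    ∃ h : ℝ → ℝ, Continuous h ∧ IsVolterraSolution (kernel A a B b) (nu A a B b) h ∧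
      ∀ x ∈ Ioo 0 (rho A B), LeftLoopIntegrable c φ₁ φ₂ (integrand A a B b x) ∧
        foxH A a B b c φ₁ φ₂ x = h (Real.log (rho A B / x)) := by
  obtain ⟨σ, hσ, h, hhc, hh, hvol, hG⟩ := hbal.exists_normRatio_eq
  obtain ⟨C, hC⟩ := hbal.exists_norm_normRatio_le_of_im_notMem hloop.1 hloop.2.1
  have hd := hloop.differentiableOn_normRatio (b := b) hbal.pos_left hbal.pos_right
  refine ⟨h, hhc, hvol, fun x hx => ?_⟩
  have ht : 0 < Real.log (rho A B / x) := Real.log_pos ((one_lt_div hx.1).2 hx.2)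
  rw [foxH, integrand_eq_normRatio_mul_cexp hbal.pos_left hbal.pos_right hx.1]
  refine ⟨leftLoopIntegrable_mul_cexp hd.continuousOn hC ht, ?_⟩
  rw [leftLoopIntegral_mul_cexp hhc hh hσ hloop.1 hloop.2.1 hd hC hG ht]
  field [Complex.I_ne_zero]

lemma IsBalanced.Q_div_eq (hbal : IsBalanced A a B b) (hx : 0 < x) (hu : x < u) :
    Q A a B b (x / u) = Real.log (u / x) * kernel A a B b (Real.log (u / x)) := by
  rw [hbal.mul_kernel (Real.log_pos ((one_lt_div hx).2 hu)), ← Real.log_inv, inv_div,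
    Real.exp_log (div_pos hx (hx.trans hu))]

end Fox

section LogSubstitution

variable {f k : ℝ → ℝ} {x r u : ℝ}

lemma continuousOn_logConvolution (hf : Continuous f) (hk : Continuous k) (hx : 0 < x) :
    ContinuousOn (fun u => f (Real.log (r / u)) * (k (Real.log (u / x)) / u)) (Icc x r) := by
  have hpos : ∀ u ∈ Icc x r, 0 < u := fun u hu => hx.trans_le hu.1
  refine (hf.comp_continuousOn (ContinuousOn.log (by fun_prop (disch := grind)) fun u hu =>
    (div_pos (hx.trans_le (hu.1.trans hu.2)) (hpos u hu)).ne')).mul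
      ((hk.comp_continuousOn (ContinuousOn.log (by fun_prop) fun u hu =>
        (div_pos (hpos u hu) hx).ne')).div continuousOn_id fun u hu => (hpos u hu).ne')

lemma integral_logConvolution (hf : Continuous f) (hk : Continuous k) (hx : 0 < x) (hr : x ≤ r) :
    ∫ u in x..r, f (Real.log (r / u)) * (k (Real.log (u / x)) / u)
      = ∫ w in (0 : ℝ)..Real.log (r / x), f w * k (Real.log (r / x) - w) := by
  have hpos : ∀ u ∈ uIcc x r, 0 < u := fun u hu => hx.trans_le (uIcc_of_le hr ▸ hu).1
  have hderiv : ∀ u ∈ uIcc x r, HasDerivAt (fun u => Real.log (u / x)) u⁻¹ u := fun u hu => by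
    have hu₀ := hpos u hu
    exact (((hasDerivAt_id u).div_const x).log (div_pos hu₀ hx).ne').congr_deriv
      (by simp only [id]; field)
  have hsubst := intervalIntegral.integral_comp_mul_deriv (a := x) (b := r)
    (g := fun v => f (Real.log (r / x) - v) * k v) hderiv
    (continuousOn_id.inv₀ fun u hu => (hpos u hu).ne') (by fun_prop)
  have hreflect := intervalIntegral.integral_comp_sub_left (a := 0) (b := Real.log (r / x))
    (fun w => f w * k (Real.log (r / x) - w)) (Real.log (r / x))
  simp only [sub_sub_cancel, sub_self, sub_zero] at hreflect
  rw [← hreflect, ← Real.log_one, ← div_self hx.ne', ← hsubst]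
  refine intervalIntegral.integral_congr fun u hu => ?_
  have hu₀ := hpos u hu
  have hlog : Real.log (r / x) - Real.log (u / x) = Real.log (r / u) := by
    rw [← Real.log_div (div_pos (hx.trans_le hr) hx).ne' (div_pos hu₀ hx).ne',
      div_div_div_cancel_right₀ hx.ne']
  simp only [Function.comp_apply, hlog]
  ring

end LogSubstitution

end FoxH

theorem corollary3p1_general {p q : ℕ} (A a : Fin p → ℝ) (B b : Fin q → ℝ)
    (hA : ∀ k, 0 < A k) (hB : ∀ j, 0 < B j) (hmu : FoxH.mu a b = 0)
    (hDelta : ∑ j, B j - ∑ k, A k = 0)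
    (c φ₁ φ₂ : ℝ) (hloop : FoxH.IsAdmissibleLoop A a c φ₁ φ₂)
    (x : ℝ) (hx : x ∈ Set.Ioo 0 (FoxH.rho A B)) :
    FoxH.LeftLoopIntegrable c φ₁ φ₂ (FoxH.integrand A a B b x) ∧
    IntervalIntegrable
      (fun u : ℝ => FoxH.foxH A a B b c φ₁ φ₂ u * ((FoxH.Q A a B b (x / u) / u : ℝ) : ℂ))
      MeasureTheory.volume x (FoxH.rho A B) ∧
    FoxH.foxH A a B b c φ₁ φ₂ x =
      1 / ((Real.log (FoxH.rho A B / x) : ℝ) : ℂ) *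
        (((FoxH.nu A a B b * FoxH.Q A a B b (x / FoxH.rho A B) : ℝ) : ℂ) +
          ∫ u in x..(FoxH.rho A B),
            FoxH.foxH A a B b c φ₁ φ₂ u * ((FoxH.Q A a B b (x / u) / u : ℝ) : ℂ)) := by
  have hbal : FoxH.IsBalanced A a B b := ⟨hA, hB, hmu, sub_eq_zero.1 hDelta⟩
  obtain ⟨h, hhc, hvol, hfox⟩ := hbal.exists_foxH_eq hloop
  have hk : Continuous fun v => v * FoxH.kernel A a B b v :=
    continuous_id.mul (FoxH.continuous_kernel A a B b)
  have hcongr : EqOn (fun u : ℝ => ((h (Real.log (FoxH.rho A B / u)) *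
        (Real.log (u / x) * FoxH.kernel A a B b (Real.log (u / x)) / u) : ℝ) : ℂ))
      (fun u : ℝ => FoxH.foxH A a B b c φ₁ φ₂ u * ((FoxH.Q A a B b (x / u) / u : ℝ) : ℂ))
      (Ioo x (FoxH.rho A B)) := fun u hu => by
    simp only [(hfox u ⟨hx.1.trans hu.1, hu.2⟩).2, hbal.Q_div_eq hx.1 hu.1, Complex.ofReal_mul]
  refine ⟨(hfox x hx).1, ?_, ?_⟩
  · refine (ContinuousOn.intervalIntegrable_of_Icc hx.2.le ?_).congr_uIoo
      (uIoo_of_le hx.2.le ▸ hcongr)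
    exact Complex.continuous_ofReal.comp_continuousOn
      (FoxH.continuousOn_logConvolution hhc hk hx.1)
  · have ht : 0 < Real.log (FoxH.rho A B / x) := Real.log_pos ((one_lt_div hx.1).2 hx.2)
    rw [← intervalIntegral.integral_congr_Ioo_of_le hx.2.le hcongr,
      intervalIntegral.integral_ofReal, FoxH.integral_logConvolution hhc hk hx.1 hx.2.le,
      (hfox x hx).2, hbal.Q_div_eq hx.1 hx.2, ← Complex.ofReal_add, ← hvol _ ht,
      Complex.ofReal_mul, one_div, inv_mul_cancel_left₀]
    exact_mod_cast ht.ne'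

theorem corollary3p1 {p q : ℕ} (A a : Fin p → ℝ) (B b : Fin q → ℝ)
    (hA : ∀ k, 0 < A k) (hB : ∀ j, 0 < B j)
    (ha : ∀ k, 0 ≤ a k) (hb : ∀ j, 0 ≤ b j)
    (hmu : FoxH.mu a b = 0) (hrho : FoxH.rho A B ≤ 1)
    (hDelta : ∑ j, B j - ∑ k, A k = 0)
    (c φ₁ φ₂ : ℝ) (hloop : FoxH.IsAdmissibleLoop A a c φ₁ φ₂)
    (x : ℝ) (hx : x ∈ Set.Ioo 0 (FoxH.rho A B)) :
    FoxH.LeftLoopIntegrable c φ₁ φ₂ (FoxH.integrand A a B b x) ∧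
    IntervalIntegrable
      (fun u : ℝ => FoxH.foxH A a B b c φ₁ φ₂ u * ((FoxH.Q A a B b (x / u) / u : ℝ) : ℂ))
      MeasureTheory.volume x (FoxH.rho A B) ∧
    FoxH.foxH A a B b c φ₁ φ₂ x =
      1 / ((Real.log (FoxH.rho A B / x) : ℝ) : ℂ) *
        (((FoxH.nu A a B b * FoxH.Q A a B b (x / FoxH.rho A B) : ℝ) : ℂ) +
          ∫ u in x..(FoxH.rho A B),
            FoxH.foxH A a B b c φ₁ φ₂ u * ((FoxH.Q A a B b (x / u) / u : ℝ) : ℂ)) :=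
  corollary3p1_general A a B b hA hB hmu hDelta c φ₁ φ₂ hloop x hx
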